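/- Let $M$ be a complex manifold (Hausdorff, second countable, not necessarily compact or connected) of dimension $n$, let $V$ be a holomorphic vector bundle over $M$ of rank $n=\dim M$, and let $s$ be a holomorphic section of $V$ whose zero locus $Z=\{x\in M : s(x)=0\}$ is compact. For $0\le i,j\le n$ let $$E^{i,j}_M=\Gamma\bigl(M,\mathcal A^{n,j}(\wedge^i V)\bigr)$$ be the space of smooth $(n,j)$-forms on $M$ with values in $\wedge^i V$, and let $E^{i,j}_{c,M}\subset E^{i,j}_M$ be the subspace of forms with compact support. Put $E_M=\bigoplus_{0\le i,j\le n}E^{i,j}_M$ and $E_{c,M}=\bigoplus_{0\le i,j\le n}E^{i,j}_{c,M}$, graded by $i+j$. On $E_M$ consider the operators $\bar\partial\colon E^{i,j}_M\to E^{i,j+1}_M$ and $s\wedge\colon E^{i,j}_M\to E^{i+1,j}_M$, where the wedge product is taken in the graded commutative algebra of $\wedge^\bullet V$-valued forms, so that $s\wedge(\beta\otimes e)=(-1)^{m}\beta\otimes(s\wedge e)$ for an $m$-form $\beta$ and a section $e$ of $\wedge^iV$. Then $\bar\partial_s:=\bar\partial+s\wedge$ satisfies $\bar\partial_s^2=0$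 and preserves $E_{c,M}$, and the inclusion $$(E_{c,M},\bar\partial_s)\longrightarrow(E_M,\bar\partial_s)$$ is a quasi-isomorphism, i.e. it induces isomorphisms on cohomology in every degree. -/

import Mathlib

open scoped Manifold Topology ContDiff

noncomputable section

namespace DolbeaultKoszul

set_option linter.unusedSectionVars false

section Local
variable {E : Type*} [NormedAddCommGroup E] [NormedSpace ℂ E]
  {G G' : Type*} [NormedAddCommGroup G] [NormedSpace ℂ G] [NormedAddCommGroup G'] [NormedSpace ℂ G']
  {m : ℕ}

/-- The conjugate-linear part `v ↦ (A v + i A (i v)) / 2` of a real-linear map `A`; for `A = df` it is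
`∂̄f`. -/
def antilinearPart {X : Type*} [NormedAddCommGroup X] [NormedSpace ℂ X]
    (A : E →L[ℝ] X) : E →L[ℝ] X :=
  (1 / 2 : ℝ) • (A + Complex.I • (A ∘L (Complex.I • ContinuousLinearMap.id ℝ E)))

theorem antilinearPart_apply {X : Type*} [NormedAddCommGroup X] [NormedSpace ℂ X]
    (A : E →L[ℝ] X) (v : E) :
    antilinearPart A v = (1 / 2 : ℝ) • (A v + Complex.I • A (Complex.I • v)) := by
  simp [antilinearPart]

/-- The operator `∂̄` on an open set of `E`, for forms with values in a fixed complex vector space: the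
alternatization of the conjugate-linear part of the derivative. On forms `f dz_I ∧ dz̄_J` it is
`∂̄f ∧ dz_I ∧ dz̄_J`, with the normalization of the exterior derivative `extDeriv`. -/
def dbarLocal (η : E → E [⋀^Fin m]→L[ℝ] G) (y : E) : E [⋀^Fin (m + 1)]→L[ℝ] G :=
  ContinuousAlternatingMap.alternatizeUncurryFin (antilinearPart (fderiv ℝ η y))

theorem dbarLocal_congr {η η' : E → E [⋀^Fin m]→L[ℝ] G} {y : E} (h : η =ᶠ[𝓝 y] η') :
    dbarLocal η y = dbarLocal η' y := by
  rw [dbarLocal, dbarLocal, h.fderiv_eq]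

/-- A complex-valued (or vector-valued) alternating `m`-form has type `(p, q)`, where `m = p + q`, if
`η (c v₁, …, c vₘ) = c ^ p * c̄ ^ q • η (v₁, …, vₘ)` for all complex `c`. Since a form of type `(a, b)`
is multiplied by `c ^ a * c̄ ^ b` and these characters are distinct, this singles out the summand of
type `(p, q)` among the forms of degree `p + q`. -/
def HasType (p q : ℕ) {W X : Type*} [AddCommGroup W] [Module ℂ W] [AddCommGroup X] [Module ℂ X] {m : ℕ}
    (η : W [⋀^Fin m]→ₗ[ℝ] X) : Prop :=
  ∀ (c : ℂ) (v : Fin m → W), η (fun k ↦ c • v k) = (c ^ p * (starRingEnd ℂ c) ^ q) • η v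

theorem fderiv_clm_comp_alternating {L : E → G →L[ℂ] G'} {η : E → E [⋀^Fin m]→L[ℝ] G} {y : E}
    (hL : DifferentiableAt ℂ L y) (hη : DifferentiableAt ℝ η y) (v : E) (u : Fin m → E):
    fderiv ℝ (fun z ↦ ((L z).restrictScalars ℝ).compContinuousAlternatingMap (η z)) y v u
      = fderiv ℂ L y v (η y u) + L y (fderiv ℝ η y v u) := by
  have h1 : HasFDerivAt (fun z ↦ (L z).restrictScalars ℝ)
      (((ContinuousLinearMap.restrictScalarsL ℂ G G' ℝ ℝ)) ∘L (fderiv ℂ L y).restrictScalars ℝ) y :=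
    ((ContinuousLinearMap.restrictScalarsL ℂ G G' ℝ ℝ).hasFDerivAt (x := L y)).comp y
      (hL.hasFDerivAt.restrictScalars ℝ)
  have h2 := (ContinuousLinearMap.compContinuousAlternatingMapCLM (ι := Fin m) ℝ E G
    G').hasFDerivAt_of_bilinear h1 hη.hasFDerivAt
  have h3 : fderiv ℝ (fun z ↦ ((L z).restrictScalars ℝ).compContinuousAlternatingMap (η z)) y
    = _ := h2.fderiv
  rw [h3]
  simp [add_comm]

theorem dbarLocal_clm {L : E → G →L[ℂ] G'} {η : E → E [⋀^Fin m]→L[ℝ] G} {y : E}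
    (hL : DifferentiableAt ℂ L y) (hη : DifferentiableAt ℝ η y) :
    dbarLocal (fun z ↦ ((L z).restrictScalars ℝ).compContinuousAlternatingMap (η z)) y
      = ((L y).restrictScalars ℝ).compContinuousAlternatingMap (dbarLocal η y) := by
  ext v
  simp only [dbarLocal, ContinuousAlternatingMap.alternatizeUncurryFin_apply,
    ContinuousLinearMap.compContinuousAlternatingMap_coe, Function.comp_apply, ContinuousLinearMap.coe_restrictScalars', map_sum, antilinearPart_apply, ContinuousAlternatingMap.smul_apply, ContinuousAlternatingMap.add_apply, fderiv_clm_comp_alternating hL hη]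
  refine Finset.sum_congr rfl fun k _ => ?_
  have h2 (u : E) (g : G): fderiv ℂ L y (Complex.I • u) g = Complex.I • fderiv ℂ L y u g := by simp
  rw [h2]
  have h3 (r : ℝ) (g : G) : L y (r • g) = r • L y g := (L y).map_smul_of_tower r g
  simp only [map_zsmul, h3, map_add, map_smul, smul_add, smul_smul, Complex.I_mul_I]
  module

theorem antilinearPart_smul {X : Type*} [NormedAddCommGroup X] [NormedSpace ℂ X]
    (A : E →L[ℝ] X) (c : ℂ) (v : E) :
    antilinearPart A (c • v) = (starRingEnd ℂ c) • antilinearPart A v := by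
  have hc (w : E) : c • w = c.re • w + c.im • (Complex.I • w) := by
    rw [← Complex.coe_smul c.re, ← Complex.coe_smul c.im, smul_smul, ← add_smul,
      Complex.re_add_im]
  have hc' (w : X) : (starRingEnd ℂ c) • w = c.re • w - c.im • (Complex.I • w) := by
    rw [← Complex.coe_smul c.re, ← Complex.coe_smul c.im, smul_smul, ← sub_smul]
    congr 1
    apply Complex.ext <;> simp
  have hI (w : X) : Complex.I • Complex.I • w = -w := by rw [smul_smul]; simp
  have hI' (w : E) : Complex.I • Complex.I • w = -w := by rw [smul_smul]; simp
  have hr (r : ℝ) (w : X) : Complex.I • r • w = r • Complex.I • w := smul_comm _ _ _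
  rw [antilinearPart_apply, antilinearPart_apply, smul_comm Complex.I c v, hc, hc, hc', hI']
  simp only [map_add, map_smul, map_neg, smul_add, smul_neg, hr, hI]
  module

theorem fderiv_type {p q : ℕ} {η : E → E [⋀^Fin m]→L[ℝ] G} {y : E}
    (hη : DifferentiableAt ℝ η y) (ht : ∀ᶠ z in 𝓝 y, HasType p q (η z).toAlternatingMap)
    (c : ℂ) (w : E) (v : Fin m → E) :
    fderiv ℝ η y w (fun k ↦ c • v k) =
      (c ^ p * (starRingEnd ℂ c) ^ q) • fderiv ℝ η y w v := by
  have key (u : Fin m → E) : HasFDerivAt (fun z ↦ η z u)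
      ((ContinuousAlternatingMap.apply ℝ E G u) ∘L fderiv ℝ η y) y :=
    (ContinuousAlternatingMap.apply ℝ E G u).hasFDerivAt.comp y hη.hasFDerivAt
  have h1 := (key v).const_smul (c ^ p * (starRingEnd ℂ c) ^ q)
  have h2 := (key (fun k ↦ c • v k)).congr_of_eventuallyEq
    (f₁ := fun z ↦ (c ^ p * (starRingEnd ℂ c) ^ q) • η z v) (by
      filter_upwards [ht] with z hz
      exact (hz c v).symm)
  exact congrArg (fun T : E →L[ℝ] G ↦ T w) (h2.unique h1)

theorem hasType_dbarLocal {p q : ℕ} {η : E → E [⋀^Fin m]→L[ℝ] G} {y : E}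
    (hη : DifferentiableAt ℝ η y) (ht : ∀ᶠ z in 𝓝 y, HasType p q (η z).toAlternatingMap) :
    HasType p (q + 1) (dbarLocal η y).toAlternatingMap := by
  intro c v
  simp only [ContinuousAlternatingMap.coe_toAlternatingMap, dbarLocal,
    ContinuousAlternatingMap.alternatizeUncurryFin_apply, Finset.smul_sum]
  refine Finset.sum_congr rfl fun k _ ↦ ?_
  rw [antilinearPart_smul, smul_comm _ ((-1 : ℤ) ^ (k : ℕ))]
  congr 1
  rw [ContinuousAlternatingMap.smul_apply]
  have : k.removeNth (fun j ↦ c • v j) = fun j ↦ c • k.removeNth v j := rfl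
  rw [this]
  simp only [antilinearPart_apply, ContinuousAlternatingMap.smul_apply,
    ContinuousAlternatingMap.add_apply, fderiv_type hη ht]
  rw [smul_comm Complex.I (c ^ p * _), ← smul_add, smul_comm (1 / 2 : ℝ) (c ^ p * _), smul_smul,
    pow_succ]
  congr 1
  ring

theorem dbarLocal_eq_extDeriv {p q : ℕ} {η : E → E [⋀^Fin m]→L[ℝ] G} {y : E}
    (hη : DifferentiableAt ℝ η y) (ht : ∀ᶠ z in 𝓝 y, HasType p q (η z).toAlternatingMap)
    (v : Fin (m + 1) → E) :
    dbarLocal η y v = (1 / 2 : ℝ) • (extDeriv η y v +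
      (Complex.I * (Complex.I ^ p * (starRingEnd ℂ Complex.I) ^ q)⁻¹) •
        extDeriv η y (fun k ↦ Complex.I • v k)) := by
  simp only [dbarLocal, extDeriv, ContinuousAlternatingMap.alternatizeUncurryFin_apply,
    Finset.smul_sum, ← Finset.sum_add_distrib]
  refine Finset.sum_congr rfl fun k _ ↦ ?_
  have h0 : Complex.I ^ p * (starRingEnd ℂ Complex.I) ^ q ≠ 0 := by simp
  have : k.removeNth (fun j ↦ Complex.I • v j) = fun j ↦ Complex.I • k.removeNth v j := rfl
  rw [this, fderiv_type hη ht, smul_comm _ ((-1 : ℤ) ^ (k : ℕ)), smul_smul, mul_assoc,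
    inv_mul_cancel₀ h0, mul_one, ← smul_add, smul_comm (1 / 2 : ℝ)]
  simp [antilinearPart_apply]

theorem dbarLocal_pullback {p q : ℕ} {η : E → E [⋀^Fin m]→L[ℝ] G} {ψ : E → E} {y : E}
    (hη : DifferentiableAt ℝ η (ψ y)) (ht : ∀ᶠ z in 𝓝 (ψ y), HasType p q (η z).toAlternatingMap)
    (hψ : ContDiffAt ℂ 2 ψ y) :
    dbarLocal (fun z ↦ (η (ψ z)).compContinuousLinearMap ((fderiv ℂ ψ z).restrictScalars ℝ)) y
      = (dbarLocal η (ψ y)).compContinuousLinearMap ((fderiv ℂ ψ y).restrictScalars ℝ) := by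
  have hψr : ContDiffAt ℝ 2 ψ y := hψ.restrict_scalars ℝ
  have hev : (fun z ↦ (η (ψ z)).compContinuousLinearMap ((fderiv ℂ ψ z).restrictScalars ℝ))
      =ᶠ[𝓝 y] fun z ↦ (η (ψ z)).compContinuousLinearMap (fderiv ℝ ψ z) := by
    filter_upwards [hψ.eventually (by simp)] with z hz
    rw [(hz.differentiableAt (by simp)).fderiv_restrictScalars ℝ]
  have hd : DifferentiableAt ℝ
      (fun z ↦ (η (ψ z)).compContinuousLinearMap (fderiv ℝ ψ z)) y := by
    refine DifferentiableAt.continuousAlternatingMapCompContinuousLinearMap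
      (hη.comp y (hψr.differentiableAt (by simp))) ?_
    exact (hψr.fderiv_right (m := 1) (by norm_num)).differentiableAt (by simp)
  have ht' : ∀ᶠ z in 𝓝 y, HasType p q ((η (ψ z)).compContinuousLinearMap
      ((fderiv ℂ ψ z).restrictScalars ℝ)).toAlternatingMap := by
    filter_upwards [hψ.continuousAt.eventually ht] with z hz c v
    simpa [Function.comp_def] using hz c (fun k ↦ fderiv ℂ ψ z (v k))
  have hd' := hd.congr_of_eventuallyEq hev
  ext v
  rw [dbarLocal_eq_extDeriv hd' ht', ContinuousAlternatingMap.compContinuousLinearMap_apply,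
    dbarLocal_eq_extDeriv hη ht, hev.extDeriv_eq, extDeriv_pullback hη hψr (by simp),
    (hψ.differentiableAt (by simp)).fderiv_restrictScalars ℝ]
  simp [Function.comp_def]

theorem exists_antilinearPartCLM (E X : Type*) [NormedAddCommGroup E] [NormedSpace ℂ E]
    [NormedAddCommGroup X] [NormedSpace ℂ X] :
    ∃ T : (E →L[ℝ] X) →L[ℝ] (E →L[ℝ] X), ∀ A, T A = antilinearPart A :=
  ⟨(1 / 2 : ℝ) • (ContinuousLinearMap.id ℝ _ +
    (ContinuousLinearMap.compL ℝ E X X (Complex.I • ContinuousLinearMap.id ℝ X)) ∘L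
    ((ContinuousLinearMap.compL ℝ E E X).flip (Complex.I • ContinuousLinearMap.id ℝ E))),
    fun A ↦ by ext v; simp [antilinearPart]⟩

theorem contDiffAt_antilinearPart {X : Type*} [NormedAddCommGroup X] [NormedSpace ℂ X]
    {r : WithTop ℕ∞} {A : E → E →L[ℝ] X} {y : E} (hA : ContDiffAt ℝ r A y) :
    ContDiffAt ℝ r (fun z ↦ antilinearPart (A z)) y := by
  obtain ⟨T, hT⟩ := exists_antilinearPartCLM E X
  simp only [← hT]
  exact T.contDiff.contDiffAt.comp y hA

theorem contDiffAt_dbarLocal {r : WithTop ℕ∞} {η : E → E [⋀^Fin m]→L[ℝ] G} {y : E}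
    (hη : ContDiffAt ℝ (r + 1) η y) : ContDiffAt ℝ r (dbarLocal η) y := by
  have h := contDiffAt_antilinearPart (hη.fderiv_right le_rfl)
  have h' : ContDiff ℝ r (ContinuousAlternatingMap.alternatizeUncurryFinCLM (n := m) ℝ E G) :=
    ContinuousLinearMap.contDiff _
  exact h'.contDiffAt.comp y h

theorem dbarLocal_dbarLocal {η : E → E [⋀^Fin m]→L[ℝ] G} {y : E} (hη : ContDiffAt ℝ 2 η y) :
    dbarLocal (dbarLocal η) y = 0 := by
  obtain ⟨T, hT⟩ := exists_antilinearPartCLM E (E [⋀^Fin m]→L[ℝ] G)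
  have hd : DifferentiableAt ℝ (fderiv ℝ η) y :=
    (hη.fderiv_right (m := 1) (by norm_num)).differentiableAt (by simp)
  have hsymm := hη.isSymmSndFDerivAt (by simp)
  have h1 : HasFDerivAt (dbarLocal η)
      (ContinuousAlternatingMap.alternatizeUncurryFinCLM ℝ E G ∘L T ∘L fderiv ℝ (fderiv ℝ η) y)
      y := by
    have := (ContinuousAlternatingMap.alternatizeUncurryFinCLM ℝ E G).hasFDerivAt.comp y
      (T.hasFDerivAt.comp y hd.hasFDerivAt)
    refine this.congr_of_eventuallyEq (.of_forall fun z ↦ ?_)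
    simp [dbarLocal, hT]
  have h2 : antilinearPart (ContinuousAlternatingMap.alternatizeUncurryFinCLM ℝ E G ∘L T ∘L
      fderiv ℝ (fderiv ℝ η) y) = ContinuousAlternatingMap.alternatizeUncurryFinCLM ℝ E G ∘L
        antilinearPart (T ∘L fderiv ℝ (fderiv ℝ η) y) := by
    ext1 w
    simp only [antilinearPart_apply, ContinuousLinearMap.comp_apply, map_add, map_smul]
    simp only [ContinuousAlternatingMap.alternatizeUncurryFinCLM_apply,
      ContinuousAlternatingMap.alternatizeUncurryFin_smul]
  rw [dbarLocal, h1.fderiv, h2]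
  refine ContinuousAlternatingMap.alternatizeUncurryFin_alternatizeUncurryFinCLM_comp_of_symmetric
    fun u w ↦ ?_
  have hs (a b : E) : fderiv ℝ (fderiv ℝ η) y a b = fderiv ℝ (fderiv ℝ η) y b a := hsymm a b
  simp only [antilinearPart_apply, ContinuousLinearMap.comp_apply, hT,
    smul_apply, add_apply]
  rw [hs w u, hs w (Complex.I • u), hs (Complex.I • w) u, hs (Complex.I • w) (Complex.I • u)]
  simp only [smul_add, smul_comm Complex.I (1 / 2 : ℝ)]
  abel

theorem dbarLocal_add {η η' : E → E [⋀^Fin m]→L[ℝ] G} {y : E} (h : DifferentiableAt ℝ η y)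
    (h' : DifferentiableAt ℝ η' y) :
    dbarLocal (η + η') y = dbarLocal η y + dbarLocal η' y := by
  rw [dbarLocal, fderiv_add h h', dbarLocal, dbarLocal,
    ← ContinuousAlternatingMap.alternatizeUncurryFin_add]
  congr 1
  ext1 v
  simp only [antilinearPart_apply, add_apply, smul_add]
  abel

theorem dbarLocal_smul {η : E → E [⋀^Fin m]→L[ℝ] G} {y : E} (h : DifferentiableAt ℝ η y)
    (c : ℂ) : dbarLocal (c • η) y = c • dbarLocal η y := by
  rw [dbarLocal, fderiv_const_smul h, dbarLocal,
    ← ContinuousAlternatingMap.alternatizeUncurryFin_smul]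
  congr 1
  ext1 v
  simp only [antilinearPart_apply, smul_apply, smul_add, smul_comm Complex.I c,
    smul_comm (1 / 2 : ℝ) c]

theorem contDiffAt_clm_comp {r : WithTop ℕ∞} {L : E → G →L[ℂ] G'}
    {η : E → E [⋀^Fin m]→L[ℝ] G} {y : E} (hL : ContDiffAt ℂ r L y) (hη : ContDiffAt ℝ r η y) :
    ContDiffAt ℝ r
      (fun z ↦ ((L z).restrictScalars ℝ).compContinuousAlternatingMap (η z)) y := by
  have h1 : ContDiffAt ℝ r (fun z ↦ (L z).restrictScalars ℝ) y :=
    (ContinuousLinearMap.restrictScalarsL ℂ G G' ℝ ℝ).contDiff.contDiffAt.comp y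
      (hL.restrict_scalars ℝ)
  have h2 : ContDiffAt ℝ r (fun z ↦ ContinuousLinearMap.compContinuousAlternatingMapCLM
      (ι := Fin m) ℝ E G G' ((L z).restrictScalars ℝ)) y :=
    (ContinuousLinearMap.contDiff _).contDiffAt.comp y h1
  exact h2.clm_apply hη

end Local

section Linear

variable {W W' : Type*} [AddCommGroup W] [Module ℂ W] [AddCommGroup W'] [Module ℂ W']

/-- Left exterior multiplication `a ↦ w ∧ a`. -/
def wedgeLeft (w : W) (i : ℕ) : ⋀[ℂ]^i W →ₗ[ℂ] ⋀[ℂ]^(i + 1) W :=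
  (LinearMap.mulLeft ℂ (ExteriorAlgebra.ι ℂ w)).restrict fun a ha ↦ by
    change _ ∈ (LinearMap.range (ExteriorAlgebra.ι ℂ (M := W))) ^ (i + 1)
    rw [pow_succ']
    exact Submodule.mul_mem_mul (LinearMap.mem_range_self _ w) ha

theorem wedgeLeft_coe (w : W) {i : ℕ} (a : ⋀[ℂ]^i W) :
    (wedgeLeft w i a : ExteriorAlgebra ℂ W) = ExteriorAlgebra.ι ℂ w * a := rfl

theorem wedgeLeft_wedgeLeft (w : W) {i : ℕ} (a : ⋀[ℂ]^i W) :
    wedgeLeft w (i + 1) (wedgeLeft w i a) = 0 := by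
  apply Subtype.ext
  rw [wedgeLeft_coe, wedgeLeft_coe, ← mul_assoc, ExteriorAlgebra.ι_sq_zero, zero_mul]
  rfl

theorem wedgeLeft_ιMulti (w : W) {i : ℕ} (v : Fin i → W) :
    wedgeLeft w i (exteriorPower.ιMulti ℂ i v) =
      exteriorPower.ιMulti ℂ (i + 1) (Fin.cons w v) := by
  apply Subtype.ext
  rw [wedgeLeft_coe, exteriorPower.ιMulti_apply_coe, exteriorPower.ιMulti_apply_coe,
    ExteriorAlgebra.ιMulti_succ_apply]
  rfl

theorem map_wedgeLeft (f : W →ₗ[ℂ] W') (w : W) {i : ℕ} (a : ⋀[ℂ]^i W) :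
    exteriorPower.map (i + 1) f (wedgeLeft w i a) =
      wedgeLeft (f w) i (exteriorPower.map i f a) := by
  have : exteriorPower.map (i + 1) f ∘ₗ wedgeLeft w i =
      wedgeLeft (f w) i ∘ₗ exteriorPower.map i f := by
    apply exteriorPower.linearMap_ext
    ext v
    simp only [LinearMap.compAlternatingMap_apply, LinearMap.comp_apply,
      exteriorPower.map_apply_ιMulti, wedgeLeft_ιMulti]
    congr 2
    ext k
    refine Fin.cases ?_ (fun j ↦ ?_) k <;> simp
  exact congrArg (fun T ↦ T a) this

theorem wedgeLeft_add (w w' : W) {i : ℕ} (a : ⋀[ℂ]^i W) :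
    wedgeLeft (w + w') i a = wedgeLeft w i a + wedgeLeft w' i a := by
  apply Subtype.ext
  simp [wedgeLeft_coe, add_mul]

theorem wedgeLeft_smul (c : ℂ) (w : W) {i : ℕ} (a : ⋀[ℂ]^i W) :
    wedgeLeft (c • w) i a = c • wedgeLeft w i a := by
  apply Subtype.ext
  simp [wedgeLeft_coe]

end Linear

section Coordinates

theorem continuous_alternating {𝕜 : Type*} [RCLike 𝕜] {E : Type*} [NormedAddCommGroup E]
    [NormedSpace 𝕜 E] [FiniteDimensional 𝕜 E] {G : Type*} [NormedAddCommGroup G]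
    [NormedSpace 𝕜 G] {m : ℕ} (f : E [⋀^Fin m]→ₗ[𝕜] G) : Continuous f := by
  let b := Module.finBasis 𝕜 E
  have : (f : (Fin m → E) → G) = fun v ↦ ∑ c : Fin m → Fin (Module.finrank 𝕜 E),
      (∏ k, b.equivFun (v k) (c k)) • f (fun k ↦ b (c k)) := by
    funext v
    have hv : v = fun k ↦ ∑ j, b.equivFun (v k) j • b j := by
      funext k; exact (b.sum_equivFun (v k)).symm
    conv_lhs => rw [hv]
    have := f.toMultilinearMap.map_sum (fun k j ↦ b.equivFun (v k) j • b j)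
    simp only [AlternatingMap.coe_multilinearMap] at this
    rw [this]
    refine Finset.sum_congr rfl fun c _ ↦ ?_
    exact f.toMultilinearMap.map_smul_univ (fun k ↦ b.equivFun (v k) (c k)) _
  rw [this]
  have hb : Continuous b.equivFun :=
    b.equivFun.toLinearMap.continuous_of_finiteDimensional
  fun_prop

/-- An alternating map on a finite-dimensional space, as a continuous alternating map. -/
def toContinuous {𝕜 : Type*} [RCLike 𝕜] {E : Type*} [NormedAddCommGroup E]
    [NormedSpace 𝕜 E] [FiniteDimensional 𝕜 E] {G : Type*} [NormedAddCommGroup G]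
    [NormedSpace 𝕜 G] {m : ℕ} (f : E [⋀^Fin m]→ₗ[𝕜] G) : E [⋀^Fin m]→L[𝕜] G :=
  { f with cont := continuous_alternating f }

@[simp] theorem toContinuous_apply {𝕜 : Type*} [RCLike 𝕜] {E : Type*} [NormedAddCommGroup E]
    [NormedSpace 𝕜 E] [FiniteDimensional 𝕜 E] {G : Type*} [NormedAddCommGroup G]
    [NormedSpace 𝕜 G] {m : ℕ} (f : E [⋀^Fin m]→ₗ[𝕜] G) (v : Fin m → E) :
    toContinuous f v = f v := rfl

/-- The coordinate space of `⋀^i F`. -/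
abbrev FrameSpace (F : Type*) [AddCommGroup F] [Module ℂ F] (i : ℕ) : Type :=
  Fin (Module.finrank ℂ (⋀[ℂ]^i F)) → ℂ

/-- Coordinates on `⋀^i F` with respect to a basis. -/
def frameEquiv (F : Type*) [AddCommGroup F] [Module ℂ F] [FiniteDimensional ℂ F] (i : ℕ) :
    ⋀[ℂ]^i F ≃ₗ[ℂ] FrameSpace F i :=
  (Module.finBasis ℂ (⋀[ℂ]^i F)).equivFun

section
variable {D : Type*} [NormedAddCommGroup D] [NormedSpace ℂ D]
  {F : Type*} [NormedAddCommGroup F] [NormedSpace ℂ F] [FiniteDimensional ℂ F]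

/-- The endomorphism `⋀^i g` in the coordinates of `frameEquiv`. -/
def frameConj (i : ℕ) (g : F →ₗ[ℂ] F) : FrameSpace F i →L[ℂ] FrameSpace F i :=
  LinearMap.toContinuousLinearMap
    ((frameEquiv F i).toLinearMap ∘ₗ exteriorPower.map i g ∘ₗ (frameEquiv F i).symm.toLinearMap)

theorem contDiffAt_clm_of_apply {G : Type*} [NormedAddCommGroup G] [NormedSpace ℂ G]
    {r : WithTop ℕ∞} {L : D → F →L[ℂ] G} {y : D}
    (h : ∀ c, ContDiffAt ℂ r (fun z ↦ L z c) y) : ContDiffAt ℂ r L y := by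
  let d := Module.finrank ℂ F
  have hd : d = Module.finrank ℂ (Fin d → ℂ) := (Module.finrank_fin_fun ℂ).symm
  let e₁ := ContinuousLinearEquiv.ofFinrankEq hd
  let e₂ := (e₁.arrowCongr (1 : G ≃L[ℂ] G)).trans (ContinuousLinearEquiv.piRing (Fin d))
  rw [← Function.id_comp L, ← e₂.symm_comp_self]
  exact e₂.symm.contDiff.contDiffAt.comp y (contDiffAt_pi.mpr fun i ↦ h _)

theorem contDiffAt_frameConj (i : ℕ) {r : WithTop ℕ∞} {g : D → F →L[ℂ] F} {y : D}
    (hg : ContDiffAt ℂ r g y) : ContDiffAt ℂ r (fun z ↦ frameConj i (g z : F →ₗ[ℂ] F)) y := by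
  refine contDiffAt_clm_of_apply fun c ↦ ?_
  have hc : (frameEquiv F i).symm c ∈ Submodule.span ℂ (Set.range (exteriorPower.ιMulti ℂ i)) := by
    rw [exteriorPower.ιMulti_span]; trivial
  change ContDiffAt ℂ r (fun z ↦ frameEquiv F i
    (exteriorPower.map i (g z : F →ₗ[ℂ] F) ((frameEquiv F i).symm c))) y
  generalize (frameEquiv F i).symm c = b at hc ⊢
  induction hc using Submodule.span_induction with
  | mem a ha =>
    obtain ⟨v, rfl⟩ := ha
    simp only [exteriorPower.map_apply_ιMulti]
    let f := toContinuous ((frameEquiv F i).toLinearMap.compAlternatingMap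
      (exteriorPower.ιMulti ℂ i (M := F)))
    have h1 : ContDiffAt ℂ r (fun z ↦ fun k ↦ g z (v k)) y :=
      contDiffAt_pi.mpr fun k ↦ hg.clm_apply contDiffAt_const
    exact f.toContinuousMultilinearMap.contDiff.contDiffAt.comp y h1
  | zero => simpa using contDiffAt_const
  | add a b _ _ ha hb => simpa using ha.add hb
  | smul t a _ ha =>
    simp only [map_smul]
    exact ha.const_smul t

/-- Exterior multiplication in the coordinates of `frameEquiv`. -/
def frameWedge (i : ℕ) : F →L[ℂ] FrameSpace F i →L[ℂ] FrameSpace F (i + 1) :=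
  LinearMap.toContinuousLinearMap
    { toFun := fun w ↦ LinearMap.toContinuousLinearMap ((frameEquiv F (i + 1)).toLinearMap ∘ₗ
        wedgeLeft w i ∘ₗ (frameEquiv F i).symm.toLinearMap)
      map_add' := fun w w' ↦ by ext1 a; simp [wedgeLeft_add]
      map_smul' := fun c w ↦ by ext1 a; simp [wedgeLeft_smul] }

theorem frameWedge_apply (i : ℕ) (w : F) (a : FrameSpace F i) :
    frameWedge i w a = frameEquiv F (i + 1) (wedgeLeft w i ((frameEquiv F i).symm a)) := rfl
end

end Coordinates

section Bundle

/-! The differential forms on a complex manifold `M` (modelled on `E`) with values in the exterior powers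
of a holomorphic vector bundle `V` (with fibre `F`). A holomorphic structure is a structure of class
`ω` over `ℂ`; smooth forms are of class `∞` over `ℝ`. -/


open Bundle

variable {E : Type*} [NormedAddCommGroup E] [NormedSpace ℂ E] [FiniteDimensional ℂ E]
  {F : Type*} [NormedAddCommGroup F] [NormedSpace ℂ F] [FiniteDimensional ℂ F]
  {M : Type*} [TopologicalSpace M] [ChartedSpace E M] [IsManifold 𝓘(ℂ, E) ω M]
  {V : M → Type*} [TopologicalSpace (TotalSpace F V)] [∀ x, AddCommGroup (V x)]
  [∀ x, Module ℂ (V x)] [∀ x, TopologicalSpace (V x)] [FiberBundle F V] [VectorBundle ℂ F V]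


variable (E V) in
/-- Complex `m`-forms at `x` with values in `⋀^i V_x`: real-multilinear alternating maps from the
(real) tangent space to the complex vector space `⋀^i V_x`. -/
abbrev FormAt (m i : ℕ) (x : M) : Type _ :=
  TangentSpace 𝓘(ℂ, E) x [⋀^Fin m]→ₗ[ℝ] ⋀[ℂ]^i (V x)

variable (F V) in
/-- The coordinates of an element of `⋀^i V_x` in the holomorphic frame at `x₀`. -/
def toFrame (i : ℕ) (x₀ x : M) : ⋀[ℂ]^i (V x) →ₗ[ℂ] FrameSpace F i :=
  (frameEquiv F i).toLinearMap ∘ₗ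
    exteriorPower.map i ((trivializationAt F V x₀).linearMapAt ℂ x)

variable (F V) in
/-- The element of `⋀^i V_x` with given coordinates in the holomorphic frame at `x₀`. -/
def ofFrame (i : ℕ) (x₀ x : M) : FrameSpace F i →ₗ[ℂ] ⋀[ℂ]^i (V x) :=
  exteriorPower.map i ((trivializationAt F V x₀).symmₗ ℂ x) ∘ₗ
    (frameEquiv F i).symm.toLinearMap

variable (F) in
/-- A form at `x`, in the holomorphic chart and the holomorphic frame at `x₀`. -/
def coordsAt {m i : ℕ} (x₀ x : M) (a : FormAt E V m i x) : E [⋀^Fin m]→L[ℝ] FrameSpace F i :=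
  toContinuous (((toFrame F V i x₀ x).restrictScalars ℝ).compAlternatingMap (a.compLinearMap
    (((trivializationAt E (TangentSpace 𝓘(ℂ, E)) x₀).symmₗ ℂ x).restrictScalars ℝ)))

variable (F) in
/-- The local representative, in the holomorphic chart and the holomorphic frame at `x₀`, of a field of
`⋀^i V`-valued forms. -/
def localRep {m i : ℕ} (x₀ : M) (α : ∀ x, FormAt E V m i x) (y : E) :
    E [⋀^Fin m]→L[ℝ] FrameSpace F i :=
  coordsAt F x₀ ((extChartAt 𝓘(ℂ, E) x₀).symm y) (α ((extChartAt 𝓘(ℂ, E) x₀).symm y))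

variable (E F V) in
/-- The open subset of `E` on which the holomorphic chart and the holomorphic frame at `x₀` are both
defined. -/
def localDomain (x₀ : M) : Set E :=
  (extChartAt 𝓘(ℂ, E) x₀).target ∩
    (extChartAt 𝓘(ℂ, E) x₀).symm ⁻¹' (trivializationAt F V x₀).baseSet

variable (F) in
/-- The form at `x` with given representative in the chart and the frame at `x`. -/
def ofCoords {m i : ℕ} (x : M) (b : E [⋀^Fin m]→L[ℝ] FrameSpace F i) : FormAt E V m i x :=
  ((ofFrame F V i x x).restrictScalars ℝ).compAlternatingMap (b.toAlternatingMap.compLinearMap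
    (((trivializationAt E (TangentSpace 𝓘(ℂ, E)) x).linearMapAt ℂ x).restrictScalars ℝ))

variable (F) in
/-- The operator `∂̄` of the holomorphic bundle `⋀^i V`, computed at `x` in the chart and the frame at
`x`. By `localRep_dbarAt` below, any other holomorphic chart and frame of the atlas give the same. -/
def dbarAt {m i : ℕ} (α : ∀ x, FormAt E V m i x) (x : M) : FormAt E V (m + 1) i x :=
  ofCoords F x (dbarLocal (localRep F x α) (extChartAt 𝓘(ℂ, E) x x))

theorem toFrame_ofFrame {i : ℕ} {x₀ x₁ x : M} (h₀ : x ∈ (trivializationAt F V x₀).baseSet)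
    (h₁ : x ∈ (trivializationAt F V x₁).baseSet) (c : FrameSpace F i) :
    toFrame F V i x₁ x (ofFrame F V i x₀ x c) =
      frameConj i (((trivializationAt F V x₀).coordChangeL ℂ (trivializationAt F V x₁) x :
        F →L[ℂ] F) : F →ₗ[ℂ] F) c := by
  simp only [toFrame, ofFrame, frameConj, LinearMap.comp_apply, LinearMap.coe_toContinuousLinearMap',
    LinearEquiv.coe_coe]
  rw [← LinearMap.comp_apply (exteriorPower.map i _) (exteriorPower.map i _),
    ← exteriorPower.map_comp]
  congr 3
  ext w
  simp [Trivialization.coordChangeL_apply, h₀, h₁, Trivialization.symmₗ_apply]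

theorem toFrame_ofFrame_self {i : ℕ} {x₀ x : M} (h₀ : x ∈ (trivializationAt F V x₀).baseSet)
    (c : FrameSpace F i) : toFrame F V i x₀ x (ofFrame F V i x₀ x c) = c := by
  simp only [toFrame, ofFrame, LinearMap.comp_apply, LinearEquiv.coe_coe]
  rw [← LinearMap.comp_apply (exteriorPower.map i _) (exteriorPower.map i _),
    ← exteriorPower.map_comp]
  have : (trivializationAt F V x₀).linearMapAt ℂ x ∘ₗ (trivializationAt F V x₀).symmₗ ℂ x = .id := by
    ext w
    exact (trivializationAt F V x₀).linearMapAt_symmₗ h₀ w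
  rw [this]
  simp

theorem ofFrame_toFrame_self {i : ℕ} {x₀ x : M} (h₀ : x ∈ (trivializationAt F V x₀).baseSet)
    (a : ⋀[ℂ]^i (V x)) : ofFrame F V i x₀ x (toFrame F V i x₀ x a) = a := by
  simp only [toFrame, ofFrame, LinearMap.comp_apply, LinearEquiv.coe_coe,
    LinearEquiv.symm_apply_apply]
  rw [← LinearMap.comp_apply (exteriorPower.map i _) (exteriorPower.map i _),
    ← exteriorPower.map_comp]
  have : (trivializationAt F V x₀).symmₗ ℂ x ∘ₗ (trivializationAt F V x₀).linearMapAt ℂ x = .id := by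
    ext w
    exact (trivializationAt F V x₀).symmₗ_linearMapAt h₀ w
  rw [this]
  simp

theorem coordsAt_apply {m i : ℕ} (x₀ x : M) (a : FormAt E V m i x) (v : Fin m → E) :
    coordsAt F x₀ x a v = toFrame F V i x₀ x
      (a fun k ↦ (trivializationAt E (TangentSpace 𝓘(ℂ, E)) x₀).symmₗ ℂ x (v k)) := rfl

theorem tangent_change {x₀ x₁ x : M} (h₀ : x ∈ (chartAt E x₀).source)
    (h₁ : x ∈ (chartAt E x₁).source) (v : E) :
    (trivializationAt E (TangentSpace 𝓘(ℂ, E)) x₀).linearMapAt ℂ x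
      ((trivializationAt E (TangentSpace 𝓘(ℂ, E)) x₁).symmₗ ℂ x v) =
      tangentCoordChange 𝓘(ℂ, E) x₁ x₀ x v := by
  have e₁ := congrArg (fun T ↦ T v)
    (TangentBundle.symmL_trivializationAt_eq_core (I := 𝓘(ℂ, E)) h₁)
  have e₀ := congrArg (fun T ↦ T ((tangentBundleCore 𝓘(ℂ, E) M).coordChange
    (achart E x₁) (achart E x) x v))
    (TangentBundle.continuousLinearMapAt_trivializationAt_eq_core (I := 𝓘(ℂ, E)) h₀)
  have e₂ := tangentCoordChange_comp (I := 𝓘(ℂ, E)) (w := x₁) (x := x) (y := x₀) (z := x) (v := v)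
    (by simp [h₀, h₁])
  rw [← e₂]
  refine Eq.trans ?_ e₀
  exact congrArg ((trivializationAt E (TangentSpace 𝓘(ℂ, E)) x₀).linearMapAt ℂ x) e₁

theorem tangent_symm_change {x₀ x₁ x : M} (h₀ : x ∈ (chartAt E x₀).source)
    (h₁ : x ∈ (chartAt E x₁).source) (v : E) :
    (trivializationAt E (TangentSpace 𝓘(ℂ, E)) x₁).symmₗ ℂ x v =
    (trivializationAt E (TangentSpace 𝓘(ℂ, E)) x₀).symmₗ ℂ x
      (tangentCoordChange 𝓘(ℂ, E) x₁ x₀ x v) := by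
  rw [← tangent_change h₀ h₁, Trivialization.symmₗ_linearMapAt]
  simpa using h₀

theorem coordsAt_ofCoords {m i : ℕ} {x₀ x : M} (h₀ : x ∈ (chartAt E x₀).source)
    (h₁ : x ∈ (trivializationAt F V x₀).baseSet) (b : E [⋀^Fin m]→L[ℝ] FrameSpace F i) :
    coordsAt F x₀ x (ofCoords F x b : FormAt E V m i x) =
      ((frameConj i (((trivializationAt F V x).coordChangeL ℂ (trivializationAt F V x₀) x :
        F →L[ℂ] F) : F →ₗ[ℂ] F)).restrictScalars ℝ).compContinuousAlternatingMap
      (b.compContinuousLinearMap ((tangentCoordChange 𝓘(ℂ, E) x₀ x x).restrictScalars ℝ)) := by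
  ext1 v
  rw [coordsAt_apply]
  simp only [ofCoords, LinearMap.compAlternatingMap_apply, LinearMap.coe_restrictScalars]
  rw [toFrame_ofFrame (mem_baseSet_trivializationAt F V x) h₁]
  simp only [AlternatingMap.compLinearMap_apply, LinearMap.coe_restrictScalars,
    tangent_change (mem_chart_source E x) h₀]
  rfl

theorem coordsAt_change {m i : ℕ} {x₀ x₁ x : M} (h₀ : x ∈ (chartAt E x₀).source)
    (h₀' : x ∈ (trivializationAt F V x₀).baseSet) (h₁ : x ∈ (chartAt E x₁).source)
    (h₁' : x ∈ (trivializationAt F V x₁).baseSet) (a : FormAt E V m i x) :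
    coordsAt F x₁ x a =
      ((frameConj i (((trivializationAt F V x₀).coordChangeL ℂ (trivializationAt F V x₁) x :
        F →L[ℂ] F) : F →ₗ[ℂ] F)).restrictScalars ℝ).compContinuousAlternatingMap
      ((coordsAt F x₀ x a).compContinuousLinearMap
        ((tangentCoordChange 𝓘(ℂ, E) x₁ x₀ x).restrictScalars ℝ)) := by
  ext1 v
  rw [coordsAt_apply]
  simp only [tangent_symm_change h₀ h₁]
  conv_lhs => rw [← ofFrame_toFrame_self h₀' (a _), toFrame_ofFrame h₀' h₁']
  rfl

theorem isOpen_localDomain (x₀ : M) : IsOpen (localDomain E F V x₀) :=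
  (continuousOn_extChartAt_symm x₀).isOpen_inter_preimage (isOpen_extChartAt_target x₀)
    (trivializationAt F V x₀).open_baseSet

theorem mem_localDomain_self (x : M) : extChartAt 𝓘(ℂ, E) x x ∈ localDomain E F V x := by
  refine ⟨mem_extChartAt_target x, ?_⟩
  simp only [Set.mem_preimage, extChartAt_to_inv]
  exact mem_baseSet_trivializationAt F V x

variable [ContMDiffVectorBundle ω F V 𝓘(ℂ, E)]

theorem localRep_change {m i : ℕ} (α : ∀ x, FormAt E V m i x) {x₀ x₁ : M} {y : E}
    (hy : y ∈ localDomain E F V x₁)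
    (h₀ : (extChartAt 𝓘(ℂ, E) x₁).symm y ∈ (chartAt E x₀).source)
    (h₀' : (extChartAt 𝓘(ℂ, E) x₁).symm y ∈ (trivializationAt F V x₀).baseSet) :
    localRep F x₁ α y =
      ((frameConj i (((trivializationAt F V x₀).coordChangeL ℂ (trivializationAt F V x₁)
        ((extChartAt 𝓘(ℂ, E) x₁).symm y) :
        F →L[ℂ] F) : F →ₗ[ℂ] F)).restrictScalars ℝ).compContinuousAlternatingMap
      ((localRep F x₀ α
        ((extChartAt 𝓘(ℂ, E) x₀ ∘ (extChartAt 𝓘(ℂ, E) x₁).symm) y)).compContinuousLinearMap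
        ((fderiv ℂ (extChartAt 𝓘(ℂ, E) x₀ ∘ (extChartAt 𝓘(ℂ, E) x₁).symm) y).restrictScalars ℝ)) := by
  have h₁ : (extChartAt 𝓘(ℂ, E) x₁).symm y ∈ (chartAt E x₁).source := by
    have := (extChartAt 𝓘(ℂ, E) x₁).map_target hy.1
    rwa [extChartAt_source] at this
  rw [localRep, coordsAt_change h₀ h₀' h₁ hy.2, tangentCoordChange_def]
  have e : (extChartAt 𝓘(ℂ, E) x₀).symm
      ((extChartAt 𝓘(ℂ, E) x₀ ∘ (extChartAt 𝓘(ℂ, E) x₁).symm) y) =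
      (extChartAt 𝓘(ℂ, E) x₁).symm y :=
    (extChartAt 𝓘(ℂ, E) x₀).left_inv (by rwa [extChartAt_source])
  rw [localRep, e, (extChartAt 𝓘(ℂ, E) x₁).right_inv hy.1]
  simp

theorem contDiffAt_transition {x₀ x₁ : M} {y : E} (hy : y ∈ (extChartAt 𝓘(ℂ, E) x₁).target)
    (h₀ : (extChartAt 𝓘(ℂ, E) x₁).symm y ∈ (chartAt E x₀).source) :
    ContDiffAt ℂ ω (extChartAt 𝓘(ℂ, E) x₀ ∘ (extChartAt 𝓘(ℂ, E) x₁).symm) y := by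
  rw [← contMDiffAt_iff_contDiffAt]
  exact (contMDiffAt_extChartAt' h₀).comp y
    ((contMDiffOn_extChartAt_symm x₁).contMDiffAt ((isOpen_extChartAt_target x₁).mem_nhds hy))

theorem contDiffAt_coordChange {x₀ x₁ : M} {y : E} (hy : y ∈ localDomain E F V x₁)
    (h₀ : (extChartAt 𝓘(ℂ, E) x₁).symm y ∈ (trivializationAt F V x₀).baseSet) :
    ContDiffAt ℂ ω (fun z ↦ ((trivializationAt F V x₀).coordChangeL ℂ (trivializationAt F V x₁)
        ((extChartAt 𝓘(ℂ, E) x₁).symm z) : F →L[ℂ] F)) y := by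
  rw [← contMDiffAt_iff_contDiffAt]
  exact (contMDiffAt_coordChangeL (IB := 𝓘(ℂ, E)) (n := ω) h₀ hy.2).comp y
    ((contMDiffOn_extChartAt_symm x₁).contMDiffAt ((isOpen_extChartAt_target x₁).mem_nhds hy.1))

theorem localRep_dbarAt {p q i : ℕ} {α : ∀ x, FormAt E V (p + q) i x}
    (hs : ∀ x₀, ContDiffOn ℝ ∞ (localRep F x₀ α) (localDomain E F V x₀))
    (ht : ∀ x, HasType p q (α x)) {x₁ : M} {y : E} (hy : y ∈ localDomain E F V x₁) :
    localRep F x₁ (dbarAt F α) y = dbarLocal (localRep F x₁ α) y := by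
  set x := (extChartAt 𝓘(ℂ, E) x₁).symm y with hx
  set ψ := extChartAt 𝓘(ℂ, E) x ∘ (extChartAt 𝓘(ℂ, E) x₁).symm with hψ
  have hψy : ψ y = extChartAt 𝓘(ℂ, E) x x := rfl
  have h₁ : x ∈ (chartAt E x₁).source := by
    have := (extChartAt 𝓘(ℂ, E) x₁).map_target hy.1
    rwa [extChartAt_source] at this
  have hev : localRep F x₁ α =ᶠ[𝓝 y] fun z ↦
      ((frameConj i (((trivializationAt F V x).coordChangeL ℂ (trivializationAt F V x₁)
        ((extChartAt 𝓘(ℂ, E) x₁).symm z) :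
        F →L[ℂ] F) : F →ₗ[ℂ] F)).restrictScalars ℝ).compContinuousAlternatingMap
      ((localRep F x α (ψ z)).compContinuousLinearMap ((fderiv ℂ ψ z).restrictScalars ℝ)) := by
    have hc : ContinuousAt (extChartAt 𝓘(ℂ, E) x₁).symm y :=
      (continuousOn_extChartAt_symm x₁).continuousAt ((isOpen_extChartAt_target x₁).mem_nhds hy.1)
    filter_upwards [(isOpen_localDomain x₁).mem_nhds hy,
      hc.preimage_mem_nhds ((chartAt E x).open_source.mem_nhds (mem_chart_source E x)),
      hc.preimage_mem_nhds ((trivializationAt F V x).open_baseSet.mem_nhds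
        (mem_baseSet_trivializationAt F V x))] with z hz hz1 hz2
    exact localRep_change α hz hz1 hz2
  have hL := (contDiffAt_frameConj i
    (contDiffAt_coordChange (x₀ := x) hy (mem_baseSet_trivializationAt F V x)))
  have hψd : ContDiffAt ℂ ω ψ y := contDiffAt_transition hy.1 (mem_chart_source E x)
  have hdom : localDomain E F V x ∈ 𝓝 (ψ y) :=
    (isOpen_localDomain x).mem_nhds (mem_localDomain_self x)
  have hη : DifferentiableAt ℝ (localRep F x α) (ψ y) :=
    ((hs x).contDiffAt hdom).differentiableAt (by simp)
  have hψr : ContDiffAt ℝ 2 ψ y := (hψd.restrict_scalars ℝ).of_le (by simp)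
  have hfd : DifferentiableAt ℝ (fun z ↦ (fderiv ℂ ψ z).restrictScalars ℝ) y := by
    have h1 : DifferentiableAt ℂ (fderiv ℂ ψ) y :=
      (hψd.fderiv_right (m := 1) (by simp)).differentiableAt (by simp)
    exact (ContinuousLinearMap.restrictScalarsL ℂ E E ℝ ℝ).differentiableAt.comp y
      (h1.restrictScalars ℝ)
  rw [dbarLocal_congr hev]
  refine Eq.trans ?_ (dbarLocal_clm (hL.differentiableAt (by simp))
    (hη.comp y (hψr.differentiableAt (by simp))
      |>.continuousAlternatingMapCompContinuousLinearMap hfd)).symm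
  simp only [Function.comp_apply (f := localRep F x α)]
  rw [dbarLocal_pullback (p := p) (q := q) hη _ (hψd.of_le (by simp))]
  · rw [localRep, dbarAt, coordsAt_ofCoords h₁ hy.2, tangentCoordChange_def]
    rw [← hx, (extChartAt 𝓘(ℂ, E) x₁).right_inv hy.1, hψy]
    simp [hψ]
  · refine .of_forall fun z c v ↦ ?_
    have := ht ((extChartAt 𝓘(ℂ, E) x).symm z) c (fun k ↦
      (trivializationAt E (TangentSpace 𝓘(ℂ, E)) x).symmₗ ℂ ((extChartAt 𝓘(ℂ, E) x).symm z) (v k))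
    simp only [ContinuousAlternatingMap.coe_toAlternatingMap, localRep, coordsAt_apply, map_smul]
    rw [this, map_smul]

theorem coordsAt_add {m i : ℕ} (x₀ x : M) (a b : FormAt E V m i x) :
    coordsAt F x₀ x (a + b) = coordsAt F x₀ x a + coordsAt F x₀ x b := by
  ext1 v
  simp [coordsAt_apply]

theorem coordsAt_smul {m i : ℕ} (x₀ x : M) (c : ℂ) (a : FormAt E V m i x) :
    coordsAt F x₀ x (c • a) = c • coordsAt F x₀ x a := by
  ext1 v
  simp [coordsAt_apply]

theorem localRep_add {m i : ℕ} (x₀ : M) (α β : ∀ x, FormAt E V m i x) :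
    localRep F x₀ (α + β) = localRep F x₀ α + localRep F x₀ β :=
  funext fun _ ↦ coordsAt_add _ _ _ _

theorem localRep_smul {m i : ℕ} (x₀ : M) (c : ℂ) (α : ∀ x, FormAt E V m i x) :
    localRep F x₀ (c • α) = c • localRep F x₀ α :=
  funext fun _ ↦ coordsAt_smul _ _ _ _

theorem localRep_zero {m i : ℕ} (x₀ : M) :
    localRep F x₀ (0 : ∀ x, FormAt E V m i x) = 0 := by
  funext y
  ext1 v
  rw [localRep, coordsAt_apply]
  exact map_zero (toFrame F V i x₀ _)

variable (E F V) in
/-- The space `Γ(M, A^{p,q}(⋀^i V))` of smooth `(p, q)`-forms on `M` with values in `⋀^i V`. -/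
def forms (p q i : ℕ) : Submodule ℂ (∀ x, FormAt E V (p + q) i x) where
  carrier := {α | (∀ x₀, ContDiffOn ℝ ∞ (localRep F x₀ α) (localDomain E F V x₀)) ∧
    ∀ x, HasType p q (α x)}
  add_mem' := fun {α β} hα hβ ↦
    ⟨fun x₀ ↦ by rw [localRep_add]; exact (hα.1 x₀).add (hβ.1 x₀),
      fun x c v ↦ by simp [hα.2 x c v, hβ.2 x c v]⟩
  zero_mem' := ⟨fun x₀ ↦ by rw [localRep_zero]; exact contDiffOn_const, fun x c v ↦ by simp⟩
  smul_mem' := fun t α hα ↦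
    ⟨fun x₀ ↦ by rw [localRep_smul]; exact (hα.1 x₀).const_smul t,
      fun x c v ↦ by
        simp only [Pi.smul_apply, AlternatingMap.smul_apply, hα.2 x c v]
        rw [smul_comm]⟩

instance (p q i : ℕ) : AddCommGroup (forms E F V p q i) :=
  @Submodule.addCommGroup ℂ (∀ x, FormAt E V (p + q) i x) _ inferInstance _ (forms E F V p q i)

instance (p q i : ℕ) : AddCommMonoid (forms E F V p q i) := AddCommGroup.toAddCommMonoid

instance (p q i : ℕ) : Module ℂ (forms E F V p q i) :=
  Submodule.module (forms E F V p q i)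

instance (p q i : ℕ) : SMul ℂ (forms E F V p q i) :=
  (inferInstance : Module ℂ (forms E F V p q i)).toSMul

theorem dbarAt_mem {p q i : ℕ} {α : ∀ x, FormAt E V (p + q) i x} (hα : α ∈ forms E F V p q i) :
    dbarAt F α ∈ forms E F V p (q + 1) i := by
  refine ⟨fun x₀ y hy ↦ ?_, fun x ↦ ?_⟩
  · have hy' := (isOpen_localDomain x₀).mem_nhds hy
    refine ContDiffAt.contDiffWithinAt (ContDiffAt.congr_of_eventuallyEq (f := dbarLocal (localRep F x₀ α)) ?_ ?_)
    · exact contDiffAt_dbarLocal ((hα.1 x₀).contDiffAt hy')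
    · filter_upwards [hy'] with z hz
      exact localRep_dbarAt hα.1 hα.2 hz
  · have h := hasType_dbarLocal (p := p) (q := q) (η := localRep F x α)
      (y := extChartAt 𝓘(ℂ, E) x x)
      (((hα.1 x).contDiffAt ((isOpen_localDomain x).mem_nhds
        (mem_localDomain_self x))).differentiableAt (by simp)) (by
        refine .of_forall fun z c v ↦ ?_
        have := hα.2 ((extChartAt 𝓘(ℂ, E) x).symm z) c (fun k ↦
          (trivializationAt E (TangentSpace 𝓘(ℂ, E)) x).symmₗ ℂ
            ((extChartAt 𝓘(ℂ, E) x).symm z) (v k))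
        simp only [ContinuousAlternatingMap.coe_toAlternatingMap, localRep, coordsAt_apply,
          map_smul]
        rw [this, map_smul])
    intro c v
    have := h c (fun k ↦ (trivializationAt E (TangentSpace 𝓘(ℂ, E)) x).linearMapAt ℂ x (v k))
    simp only [dbarAt, ofCoords, LinearMap.compAlternatingMap_apply,
      AlternatingMap.compLinearMap_apply, LinearMap.coe_restrictScalars, map_smul]
    rw [← map_smul]
    exact congrArg _ this

variable (E F V) in
/-- `∂̄ : Γ(M, A^{p,q}(⋀^i V)) → Γ(M, A^{p,q+1}(⋀^i V))`. -/
def dbar (p q i : ℕ) : forms E F V p q i →ₗ[ℂ] forms E F V p (q + 1) i where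
  toFun α := ⟨dbarAt F α.1, dbarAt_mem α.2⟩
  map_add' α β := by
    apply Subtype.ext
    funext x
    have h (γ : forms E F V p q i) :=
      ((γ.2.1 x).contDiffAt ((isOpen_localDomain x).mem_nhds
        (mem_localDomain_self x))).differentiableAt (by simp)
    change dbarAt F (α.1 + β.1) x = dbarAt F α.1 x + dbarAt F β.1 x
    rw [dbarAt, localRep_add, dbarLocal_add (h α) (h β)]
    ext v
    simp [dbarAt, ofCoords]
  map_smul' c α := by
    apply Subtype.ext
    funext x
    have h := ((α.2.1 x).contDiffAt ((isOpen_localDomain x).mem_nhds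
        (mem_localDomain_self x))).differentiableAt (by simp)
    change dbarAt F (c • α.1) x = c • dbarAt F α.1 x
    rw [dbarAt, localRep_smul, dbarLocal_smul h]
    ext v
    simp [dbarAt, ofCoords]

theorem dbar_coe {p q i : ℕ} (α : forms E F V p q i) :
    (dbar E F V p q i α : ∀ x, FormAt E V (p + q + 1) i x) = dbarAt F α.1 := rfl

theorem ofCoords_zero {m i : ℕ} (x : M) :
    (ofCoords F x 0 : FormAt E V m i x) = 0 := by
  ext v
  simp [ofCoords]

theorem dbar_dbar {p q i : ℕ} (α : forms E F V p q i) :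
    dbar E F V p (q + 1) i (dbar E F V p q i α) = 0 := by
  apply Subtype.ext
  funext x
  have hx := (isOpen_localDomain (E := E) (F := F) (V := V) x).mem_nhds (mem_localDomain_self x)
  change dbarAt F (dbarAt F α.1) x = 0
  have hev : localRep F x (dbarAt F α.1) =ᶠ[𝓝 (extChartAt 𝓘(ℂ, E) x x)]
      dbarLocal (localRep F x α.1) := by
    filter_upwards [hx] with z hz
    exact localRep_dbarAt α.2.1 α.2.2 hz
  rw [dbarAt, dbarLocal_congr hev,
    dbarLocal_dbarLocal (contDiffAt_infty.1 ((α.2.1 x).contDiffAt hx) 2), ofCoords_zero]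

/-- The product `s ∧ α` in the graded commutative algebra of forms with values in the exterior algebra of
`V`, in which an `m`-form with values in `⋀^i V` has degree `m + i`:
`s ∧ (β ⊗ e) = (-1) ^ m β ⊗ (s ∧ e)` for an `m`-form `β`. -/
def wedgeAt {m i : ℕ} (s : ∀ x, V x) (α : ∀ x, FormAt E V m i x) (x : M) :
    FormAt E V m (i + 1) x :=
  (-1 : ℂ) ^ m • ((wedgeLeft (s x) i).restrictScalars ℝ).compAlternatingMap (α x)

theorem toFrame_wedgeLeft {i : ℕ} (x₀ x : M) (w : V x) (a : ⋀[ℂ]^i (V x)) :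
    toFrame F V (i + 1) x₀ x (wedgeLeft w i a) =
      frameWedge i ((trivializationAt F V x₀).linearMapAt ℂ x w) (toFrame F V i x₀ x a) := by
  simp [toFrame, map_wedgeLeft, frameWedge_apply]

theorem localRep_wedgeAt {m i : ℕ} (s : ∀ x, V x) (α : ∀ x, FormAt E V m i x) (x₀ : M) (y : E) :
    localRep F x₀ (wedgeAt s α) y = (((-1 : ℂ) ^ m • frameWedge i
      ((trivializationAt F V x₀).linearMapAt ℂ ((extChartAt 𝓘(ℂ, E) x₀).symm y)
        (s ((extChartAt 𝓘(ℂ, E) x₀).symm y)))).restrictScalars ℝ).compContinuousAlternatingMap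
          (localRep F x₀ α y) := by
  ext1 v
  rw [localRep, coordsAt_apply]
  change toFrame F V (i + 1) x₀ _ ((-1 : ℂ) ^ m • wedgeLeft _ i (α _ _)) = _
  rw [map_smul, toFrame_wedgeLeft]
  rfl

theorem ofFrame_frameWedge {i : ℕ} {x₀ x : M} (h : x ∈ (trivializationAt F V x₀).baseSet)
    (w : V x) (c : FrameSpace F i) :
    ofFrame F V (i + 1) x₀ x
      (frameWedge i ((trivializationAt F V x₀).linearMapAt ℂ x w) c) =
      wedgeLeft w i (ofFrame F V i x₀ x c) := by
  rw [← ofFrame_toFrame_self h (wedgeLeft w i _), toFrame_wedgeLeft, toFrame_ofFrame_self h]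

theorem contDiffAt_section (s : Cₛ^ω⟮𝓘(ℂ, E); F, V⟯) (x₀ : M) {y : E}
    (hy : y ∈ localDomain E F V x₀) :
    ContDiffAt ℂ ω (fun z ↦ (trivializationAt F V x₀).linearMapAt ℂ
      ((extChartAt 𝓘(ℂ, E) x₀).symm z) (s ((extChartAt 𝓘(ℂ, E) x₀).symm z))) y := by
  have h1 := ((trivializationAt F V x₀).contMDiffAt_section_iff (IB := 𝓘(ℂ, E)) (n := ω)
    (s := s) hy.2).1 s.contMDiff.contMDiffAt
  have h2 := h1.comp y
    ((contMDiffOn_extChartAt_symm (I := 𝓘(ℂ, E)) (n := ω) x₀).contMDiffAt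
      ((isOpen_extChartAt_target x₀).mem_nhds hy.1))
  refine h2.contDiffAt.congr_of_eventuallyEq ?_
  filter_upwards [(isOpen_localDomain x₀).mem_nhds hy] with z hz
  rw [Trivialization.coe_linearMapAt_of_mem _ hz.2]
  rfl

theorem contDiffAt_wedgeFrame (s : Cₛ^ω⟮𝓘(ℂ, E); F, V⟯) (x₀ : M) {y : E} (m i : ℕ)
    (hy : y ∈ localDomain E F V x₀) :
    ContDiffAt ℂ ω (fun z ↦ (-1 : ℂ) ^ m • frameWedge i ((trivializationAt F V x₀).linearMapAt ℂ
      ((extChartAt 𝓘(ℂ, E) x₀).symm z) (s ((extChartAt 𝓘(ℂ, E) x₀).symm z)))) y :=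
  ((frameWedge (F := F) i).contDiff.contDiffAt.comp y (contDiffAt_section s x₀ hy)).const_smul _

theorem wedgeAt_mem (s : Cₛ^ω⟮𝓘(ℂ, E); F, V⟯) {p q i : ℕ} {α : ∀ x, FormAt E V (p + q) i x}
    (hα : α ∈ forms E F V p q i) : wedgeAt s α ∈ forms E F V p q (i + 1) := by
  refine ⟨fun x₀ y hy ↦ ?_, fun x c v ↦ ?_⟩
  · have hy' := (isOpen_localDomain x₀).mem_nhds hy
    refine ContDiffAt.contDiffWithinAt ?_
    rw [funext (localRep_wedgeAt s α x₀)]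
    exact contDiffAt_clm_comp ((contDiffAt_wedgeFrame s x₀ _ i hy).of_le le_top)
      ((hα.1 x₀).contDiffAt hy')
  · have := hα.2 x c v
    simp only [wedgeAt, AlternatingMap.smul_apply, LinearMap.compAlternatingMap_apply,
      LinearMap.coe_restrictScalars, this, map_smul]
    rw [smul_comm]

/-- `s ∧ : Γ(M, A^{p,q}(⋀^i V)) → Γ(M, A^{p,q}(⋀^{i+1} V))`. -/
def wedgeSection (s : Cₛ^ω⟮𝓘(ℂ, E); F, V⟯) (p q i : ℕ) :
    forms E F V p q i →ₗ[ℂ] forms E F V p q (i + 1) where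
  toFun α := ⟨wedgeAt s α.1, wedgeAt_mem s α.2⟩
  map_add' α β := by
    apply Subtype.ext
    funext x
    ext v
    simp [wedgeAt]
  map_smul' c α := by
    apply Subtype.ext
    funext x
    ext v
    simp [wedgeAt, smul_comm c]

theorem wedgeSection_wedgeSection (s : Cₛ^ω⟮𝓘(ℂ, E); F, V⟯) {p q i : ℕ} (α : forms E F V p q i) :
    wedgeSection s p q (i + 1) (wedgeSection s p q i α) = 0 := by
  apply Subtype.ext
  funext x
  ext v
  simp [wedgeSection, wedgeAt, wedgeLeft_wedgeLeft]

theorem dbar_wedgeSection (s : Cₛ^ω⟮𝓘(ℂ, E); F, V⟯) {p q i : ℕ} (α : forms E F V p q i) :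
    dbar E F V p q (i + 1) (wedgeSection s p q i α) +
      wedgeSection s p (q + 1) i (dbar E F V p q i α) = 0 := by
  apply Subtype.ext
  funext x
  have hx := mem_localDomain_self (E := E) (F := F) (V := V) x
  have hx' := (isOpen_localDomain (E := E) (F := F) (V := V) x).mem_nhds hx
  change dbarAt F (wedgeAt s α.1) x + wedgeAt s (dbarAt F α.1) x = 0
  rw [dbarAt, funext (localRep_wedgeAt s α.1 x),
    dbarLocal_clm ((contDiffAt_wedgeFrame s x _ i hx).differentiableAt (by simp))
      (((α.2.1 x).contDiffAt hx').differentiableAt (by simp))]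
  have e : (extChartAt 𝓘(ℂ, E) x).symm (extChartAt 𝓘(ℂ, E) x x) = x := extChartAt_to_inv x
  rw [e]
  ext1 v
  change ofFrame F V (i + 1) x x ((-1 : ℂ) ^ (p + q) • frameWedge i _ _) +
    (-1 : ℂ) ^ (p + q + 1) • wedgeLeft (s x) i (ofFrame F V i x x _) = 0
  rw [map_smul, ofFrame_frameWedge (mem_baseSet_trivializationAt F V x), pow_succ, mul_neg_one]
  have key (c : ℂ) (a : ⋀[ℂ]^(i + 1) (V x)) : c • a + (-c) • a = 0 := by
    rw [← add_smul, add_neg_cancel, zero_smul]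
  exact key _ _

variable (E F V) in
/-- The forms with compact support. -/
def compactForms (p q i : ℕ) : Submodule ℂ (forms E F V p q i) where
  carrier := {α | IsCompact (closure {x | α.1 x ≠ 0})}
  add_mem' := fun {α β} hα hβ ↦ by
    refine (hα.union hβ).of_isClosed_subset isClosed_closure ?_
    rw [← closure_union]
    refine closure_mono fun x hx ↦ ?_
    by_contra h
    simp only [Set.mem_union, Set.mem_ofPred_eq, not_or, not_not] at h
    exact hx (by simp [h.1, h.2])
  zero_mem' := by simp
  smul_mem' := fun c α hα ↦ by
    refine hα.of_isClosed_subset isClosed_closure (closure_mono fun x hx h ↦ hx ?_)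
    simp [h]

theorem dbar_mem_compactForms {p q i : ℕ} {α : forms E F V p q i}
    (hα : α ∈ compactForms E F V p q i) :
    dbar E F V p q i α ∈ compactForms E F V p (q + 1) i := by
  refine hα.of_isClosed_subset isClosed_closure (closure_minimal (fun x hx ↦ ?_) isClosed_closure)
  by_contra h
  apply hx
  change dbarAt F α.1 x = 0
  have hc : ContinuousAt (extChartAt 𝓘(ℂ, E) x).symm (extChartAt 𝓘(ℂ, E) x x) :=
    continuousAt_extChartAt_symm x
  have hn : (closure {x | α.1 x ≠ 0})ᶜ ∈
      𝓝 ((extChartAt 𝓘(ℂ, E) x).symm (extChartAt 𝓘(ℂ, E) x x)) := by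
    rw [extChartAt_to_inv]
    exact isClosed_closure.isOpen_compl.mem_nhds h
  have hev : localRep F x α.1 =ᶠ[𝓝 (extChartAt 𝓘(ℂ, E) x x)] 0 := by
    filter_upwards [hc.preimage_mem_nhds hn] with z hz
    have hz' : α.1 ((extChartAt 𝓘(ℂ, E) x).symm z) = 0 := by
      by_contra h'
      exact hz (subset_closure h')
    ext1 v
    rw [localRep, coordsAt_apply, hz']
    exact map_zero (toFrame F V i x _)
  have h0 : dbarLocal (0 : E → E [⋀^Fin (p + q)]→L[ℝ] FrameSpace F i)
      (extChartAt 𝓘(ℂ, E) x x) = 0 := by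
    have := dbarLocal_smul (η := (0 : E → E [⋀^Fin (p + q)]→L[ℝ] FrameSpace F i))
      (y := extChartAt 𝓘(ℂ, E) x x) (differentiableAt_const 0) 0
    simpa using this
  rw [dbarAt, dbarLocal_congr hev, h0, ofCoords_zero]

theorem wedgeSection_mem_compactForms (s : Cₛ^ω⟮𝓘(ℂ, E); F, V⟯) {p q i : ℕ}
    {α : forms E F V p q i} (hα : α ∈ compactForms E F V p q i) :
    wedgeSection s p q i α ∈ compactForms E F V p q (i + 1) := by
  refine hα.of_isClosed_subset isClosed_closure (closure_mono fun x hx h ↦ hx ?_)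
  change wedgeAt s α.1 x = 0
  rw [wedgeAt, h]
  ext v
  simp

variable (E F V) in
/-- Families `(α i j)` with `α i j` in `E^{i,j} = Γ(M, A^{p,j}(⋀^i V))`. For `i` above the rank of `V` or
`j` above the dimension of `M` these spaces are zero, so for `p = dim M = rk V = n` this is
`⨁_{0 ≤ i, j ≤ n} E^{i,j}`. -/
def DoubleComplex (p : ℕ) : Type _ := ∀ i j : ℕ, forms E F V p j i

instance (p : ℕ) : AddCommGroup (DoubleComplex E F V p) := Pi.addCommGroup

instance (p : ℕ) : Module ℂ (DoubleComplex E F V p) :=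
  Pi.module ℕ (fun i ↦ ∀ j : ℕ, forms E F V p j i) ℂ

theorem DoubleComplex.add_apply {p : ℕ} (α β : DoubleComplex E F V p) (i j : ℕ) :
    (α + β) i j = α i j + β i j := rfl

theorem DoubleComplex.smul_apply {p : ℕ} (c : ℂ) (α : DoubleComplex E F V p) (i j : ℕ) :
    (c • α) i j = c • (α i j : forms E F V p j i) := rfl

/-- The components of `∂̄ α`. -/
def dbarPart {p : ℕ} (α : DoubleComplex E F V p) (i : ℕ) : ∀ j : ℕ, forms E F V p j i
  | 0 => 0
  | j + 1 => dbar E F V p j i (α i j)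

/-- The components of `s ∧ α`. -/
def wedgePart (s : Cₛ^ω⟮𝓘(ℂ, E); F, V⟯) {p : ℕ} (α : DoubleComplex E F V p) :
    ∀ i j : ℕ, forms E F V p j i
  | 0, _ => 0
  | i + 1, j => wedgeSection s p j i (α i j)

/-- The operator `∂̄_s = ∂̄ + s ∧`. -/
def dbarS (s : Cₛ^ω⟮𝓘(ℂ, E); F, V⟯) (p : ℕ) :
    DoubleComplex E F V p →ₗ[ℂ] DoubleComplex E F V p where
  toFun α i j := dbarPart α i j + wedgePart s α i j
  map_add' α β := by
    funext i j
    have h1 : dbarPart (α + β) i j = dbarPart α i j + dbarPart β i j := by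
      rcases j with _ | j
      · exact (add_zero _).symm
      · exact map_add (dbar E F V p j i) _ _
    have h2 : wedgePart s (α + β) i j = wedgePart s α i j + wedgePart s β i j := by
      rcases i with _ | i
      · exact (add_zero _).symm
      · exact map_add (wedgeSection s p j i) _ _
    change dbarPart (α + β) i j + wedgePart s (α + β) i j = _ + _
    rw [h1, h2]
    exact add_add_add_comm _ _ _ _
  map_smul' c α := by
    funext i j
    have h1 : dbarPart (c • α) i j = c • dbarPart α i j := by
      rcases j with _ | j
      · exact (smul_zero c).symm
      · exact map_smul (dbar E F V p j i) _ _
    have h2 : wedgePart s (c • α) i j = c • wedgePart s α i j := by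
      rcases i with _ | i
      · exact (smul_zero c).symm
      · exact map_smul (wedgeSection s p j i) _ _
    change dbarPart (c • α) i j + wedgePart s (c • α) i j = c • (_ + _)
    rw [h1, h2]
    exact (smul_add _ _ _).symm

theorem dbarS_apply (s : Cₛ^ω⟮𝓘(ℂ, E); F, V⟯) (p : ℕ) (α : DoubleComplex E F V p) (i j : ℕ) :
    dbarS s p α i j = dbarPart α i j + wedgePart s α i j := rfl

theorem dbarS_dbarS (s : Cₛ^ω⟮𝓘(ℂ, E); F, V⟯) (p : ℕ) (α : DoubleComplex E F V p) :
    dbarS s p (dbarS s p α) = 0 := by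
  funext i j
  have h1 : dbarPart (dbarS s p α) i j =
      dbarPart (fun i j ↦ wedgePart s α i j : DoubleComplex E F V p) i j := by
    rcases j with _ | j
    · rfl
    · change dbar E F V p j i (dbarPart α i j + wedgePart s α i j) =
        dbar E F V p j i (wedgePart s α i j)
      rw [map_add]
      refine add_eq_right.2 ?_
      rcases j with _ | j
      · exact map_zero _
      · exact dbar_dbar _
  have h2 : wedgePart s (dbarS s p α) i j =
      wedgePart s (fun i j ↦ dbarPart α i j : DoubleComplex E F V p) i j := by
    rcases i with _ | i
    · rfl
    · change wedgeSection s p j i (dbarPart α i j + wedgePart s α i j) =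
        wedgeSection s p j i (dbarPart α i j)
      rw [map_add]
      refine add_eq_left.2 ?_
      rcases i with _ | i
      · exact map_zero _
      · exact wedgeSection_wedgeSection s _
  rw [dbarS_apply, h1, h2]
  rcases i with _ | i <;> rcases j with _ | j
  · exact add_zero _
  · exact (add_zero _).trans (map_zero (dbar E F V p j 0))
  · exact (zero_add _).trans (map_zero (wedgeSection s p 0 i))
  · exact dbar_wedgeSection s (α i j)

variable (E F V) in
/-- The elements of total degree `k`, that is, with components in the `E^{i,j}` with `i + j = k` only. -/
def totalDegree (p k : ℕ) : Submodule ℂ (DoubleComplex E F V p) where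
  carrier := {α | ∀ i j, i + j ≠ k → α i j = 0}
  add_mem' := fun {α β} hα hβ i j h ↦ by
    rw [DoubleComplex.add_apply, hα i j h, hβ i j h]
    exact add_zero _
  zero_mem' := fun _ _ _ ↦ rfl
  smul_mem' := fun c α hα i j h ↦ by
    rw [DoubleComplex.smul_apply, hα i j h]
    exact smul_zero c

variable (E F V) in
/-- The elements of total degree `k` all of whose components have compact support. -/
def compactTotalDegree (p k : ℕ) : Submodule ℂ (DoubleComplex E F V p) where
  carrier := {α | α ∈ totalDegree E F V p k ∧ ∀ i j, α i j ∈ compactForms E F V p j i}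
  add_mem' := fun hα hβ ↦
    ⟨add_mem hα.1 hβ.1, fun i j ↦ add_mem (hα.2 i j) (hβ.2 i j)⟩
  zero_mem' := ⟨zero_mem _, fun _ _ ↦ zero_mem _⟩
  smul_mem' := fun c _ hα ↦
    ⟨Submodule.smul_mem _ c hα.1, fun i j ↦ Submodule.smul_mem _ c (hα.2 i j)⟩

theorem dbarS_mem (s : Cₛ^ω⟮𝓘(ℂ, E); F, V⟯) (p k : ℕ) {α : DoubleComplex E F V p}
    (hα : α ∈ totalDegree E F V p k) : dbarS s p α ∈ totalDegree E F V p (k + 1) := by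
  intro i j h
  have h1 : dbarPart α i j = 0 := by
    rcases j with _ | j
    · rfl
    · exact (congrArg (dbar E F V p j i) (hα i j (by omega))).trans (map_zero _)
  have h2 : wedgePart s α i j = 0 := by
    rcases i with _ | i
    · rfl
    · exact (congrArg (wedgeSection s p j i) (hα i j (by omega))).trans (map_zero _)
  rw [dbarS_apply, h1, h2]
  exact add_zero _

theorem dbarS_mem_compact (s : Cₛ^ω⟮𝓘(ℂ, E); F, V⟯) (p k : ℕ) {α : DoubleComplex E F V p}
    (hα : α ∈ compactTotalDegree E F V p k) :
    dbarS s p α ∈ compactTotalDegree E F V p (k + 1) := by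
  refine ⟨dbarS_mem s p k hα.1, fun i j ↦ ?_⟩
  refine add_mem ?_ ?_
  · rcases j with _ | j
    · exact zero_mem _
    · exact dbar_mem_compactForms (hα.2 i j)
  · rcases i with _ | i
    · exact zero_mem _
    · exact wedgeSection_mem_compactForms s (hα.2 i j)

open CategoryTheory

/-- The cochain complex `(E, ∂̄_s)`, graded by `i + j`. -/
def complexE (s : Cₛ^ω⟮𝓘(ℂ, E); F, V⟯) (p : ℕ) : CochainComplex (ModuleCat ℂ) ℕ :=
  CochainComplex.of (fun k ↦ ModuleCat.of ℂ (totalDegree E F V p k))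
    (fun k ↦ ModuleCat.ofHom ((dbarS s p).restrict fun _ hα ↦ dbarS_mem s p k hα))
    (fun _ ↦ ModuleCat.hom_ext (LinearMap.ext fun α ↦ Subtype.ext (dbarS_dbarS s p α.1)))

/-- The cochain complex `(E_c, ∂̄_s)` of forms with compact support, graded by `i + j`. -/
def complexEc (s : Cₛ^ω⟮𝓘(ℂ, E); F, V⟯) (p : ℕ) : CochainComplex (ModuleCat ℂ) ℕ :=
  CochainComplex.of (fun k ↦ ModuleCat.of ℂ (compactTotalDegree E F V p k))
    (fun k ↦ ModuleCat.ofHom ((dbarS s p).restrict fun _ hα ↦ dbarS_mem_compact s p k hα))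
    (fun _ ↦ ModuleCat.hom_ext (LinearMap.ext fun α ↦ Subtype.ext (dbarS_dbarS s p α.1)))

theorem complexE_d (s : Cₛ^ω⟮𝓘(ℂ, E); F, V⟯) (p k : ℕ) :
    (complexE s p).d k (k + 1) =
      ModuleCat.ofHom ((dbarS s p).restrict fun _ hα ↦ dbarS_mem s p k hα) :=
  CochainComplex.of_d (fun k ↦ ModuleCat.of ℂ (totalDegree E F V p k))
    (fun k ↦ ModuleCat.ofHom ((dbarS s p).restrict fun _ hα ↦ dbarS_mem s p k hα)) k

theorem complexEc_d (s : Cₛ^ω⟮𝓘(ℂ, E); F, V⟯) (p k : ℕ) :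
    (complexEc s p).d k (k + 1) =
      ModuleCat.ofHom ((dbarS s p).restrict fun _ hα ↦ dbarS_mem_compact s p k hα) :=
  CochainComplex.of_d (fun k ↦ ModuleCat.of ℂ (compactTotalDegree E F V p k))
    (fun k ↦ ModuleCat.ofHom ((dbarS s p).restrict fun _ hα ↦ dbarS_mem_compact s p k hα)) k

/-- The inclusion `(E_c, ∂̄_s) → (E, ∂̄_s)`. -/
def inclusionEc (s : Cₛ^ω⟮𝓘(ℂ, E); F, V⟯) (p : ℕ) : complexEc s p ⟶ complexE s p :=
  CochainComplex.ofHom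
    (fun _ ↦ ModuleCat.ofHom (Submodule.inclusion (fun _ hα ↦ hα.1)))
    (fun k ↦ by
      rw [complexE_d, complexEc_d]
      rfl)

end Bundle

end DolbeaultKoszul

end

/-! ### Homological algebra: a criterion for quasi-isomorphism. -/

section

open CategoryTheory

/-! Outside the compact zero locus `s` never vanishes, so there the Koszul differential `s ∧` is
contractible, and a compact set is invisible modulo compactly supported forms. Concretely, a
partition of unity gives a smooth section `θ` of the dual bundle with `θ(s) = 1` off some compact
`K` (`exists_dual_eq_one_off_compact`). Write `h` for contraction with `θ`. Contraction is an
antiderivation, so `h (s ∧ α) + s ∧ h α = θ(s) α`, which equals `α` off `K` (`contractAt_wedgeAt`).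

The theorem amounts to acyclicity of `E / E_c`: if `γ` has degree `k` and `∂̄_s γ` has compact
support, then `γ - ∂̄_s β` has compact support for some `β` of degree `k - 1`. To find `β`, the
exterior degree `i` is descended. Suppose that the components of `γ` with `i > N` have compact
support, and replace `γ` by `γ - ∂̄_s h γ`. For `i ≥ N` its component in bidegree `(i, j)` is `(γ -
s ∧ h γ) - ∂̄ h γ`. The last term is compactly supported because `h γ` in row `i` comes from row `i
+ 1` of `γ`. Off `K` the bracket equals `h (s ∧ γ)`, and `s ∧ γ` in row `i + 1` is `∂̄_s γ` minus
`∂̄` of row `i + 1` of `γ`, both compactly supported. So one more row has become compact, while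
`∂̄_s γ` is unchanged. In total degree `k` the rows above `k` are zero, so `k + 1` corrections
suffice (`exists_sub_dbarS_mem_compactForms`).

Only locality of `∂̄` enters, never a commutator of `∂̄` with `h`; this is why a smooth,
non-holomorphic `θ` is enough. -/

/-- The hypothesis `h` is acyclicity of the quotient `L / K`, stated without forming the quotient:
an element whose differential lies in `K` is, modulo boundaries, itself in `K`. With `c = 0` it
gives surjectivity on cohomology. Applied to a primitive in `L` of a cocycle of `K`, it moves that
primitive into `K`, which gives injectivity. -/
theorem quasiIso_of_injective_of_forall_exists {R : Type*} [Ring R]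
    {K L : CochainComplex (ModuleCat R) ℕ} (f : K ⟶ L)
    (hf : ∀ k, Function.Injective (f.f k))
    (h : ∀ (k : ℕ) (y : L.X k) (c : K.X (k + 1)), L.d k (k + 1) y = f.f (k + 1) c →
      ∃ (x : K.X k) (b : L.X ((ComplexShape.up ℕ).prev k)), y = f.f k x + L.d _ k b) :
    QuasiIso f := by
  have hπ (C : CochainComplex (ModuleCat R) ℕ) (k : ℕ) :
      Function.Surjective (C.homologyπ k) := (ModuleCat.epi_iff_surjective _).1 inferInstance
  have hi (C : CochainComplex (ModuleCat R) ℕ) (k : ℕ) :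
      Function.Injective (C.iCycles k) := (ModuleCat.mono_iff_injective _).1 inferInstance
  have hker (C : CochainComplex (ModuleCat R) ℕ) (k : ℕ) (x : C.X k)
      (hx : C.d k (k + 1) x = 0) : ∃ w, C.iCycles k w = x :=
    (ShortComplex.moduleCat_exact_iff _).1 (ShortComplex.exact_of_f_is_kernel
      (.mk (C.iCycles k) (C.d k (k + 1)) (C.iCycles_d k (k + 1)))
      (C.cyclesIsKernel k (k + 1) (by simp))) x hx
  have hcoker (C : CochainComplex (ModuleCat R) ℕ) (k : ℕ) (z : C.cycles k)
      (hz : C.homologyπ k z = 0) : ∃ b, C.toCycles ((ComplexShape.up ℕ).prev k) k b = z :=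
    (ShortComplex.moduleCat_exact_iff _).1 (ShortComplex.exact_of_g_is_cokernel
      (.mk (C.toCycles _ k) (C.homologyπ k) (C.toCycles_comp_homologyπ _ k))
      (C.homologyIsCokernel _ k rfl)) z hz
  have hcomm (i j : ℕ) (x : K.X i) : f.f j (K.d i j x) = L.d i j (f.f i x) :=
    (ConcreteCategory.congr_hom (f.comm i j) x).symm
  have hcyc (k : ℕ) (z : K.cycles k) : L.iCycles k (HomologicalComplex.cyclesMap f k z) =
      f.f k (K.iCycles k z) :=
    ConcreteCategory.congr_hom (HomologicalComplex.cyclesMap_i f k) z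
  have hhom (k : ℕ) (z : K.cycles k) : HomologicalComplex.homologyMap f k (K.homologyπ k z) =
      L.homologyπ k (HomologicalComplex.cyclesMap f k z) :=
    ConcreteCategory.congr_hom (HomologicalComplex.homologyπ_naturality f k) z
  have htoi (C : CochainComplex (ModuleCat R) ℕ) (i k : ℕ) (b : C.X i) :
      C.iCycles k (C.toCycles i k b) = C.d i k b :=
    ConcreteCategory.congr_hom (C.toCycles_i i k) b
  have htoπ (C : CochainComplex (ModuleCat R) ℕ) (i k : ℕ) (b : C.X i) :
      C.homologyπ k (C.toCycles i k b) = 0 :=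
    ConcreteCategory.congr_hom (C.toCycles_comp_homologyπ i k) b
  have hid (C : CochainComplex (ModuleCat R) ℕ) (k l : ℕ) (z : C.cycles k) :
      C.d k l (C.iCycles k z) = 0 :=
    ConcreteCategory.congr_hom (C.iCycles_d k l) z
  have hdd (C : CochainComplex (ModuleCat R) ℕ) (i j k : ℕ) (b : C.X i) :
      C.d j k (C.d i j b) = 0 :=
    ConcreteCategory.congr_hom (C.d_comp_d i j k) b
  rw [quasiIso_iff]
  intro k
  rw [quasiIsoAt_iff_isIso_homologyMap]
  have h1 : Mono (HomologicalComplex.homologyMap f k) := by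
    rw [ModuleCat.mono_iff_injective, injective_iff_map_eq_zero]
    intro x hx
    obtain ⟨z, rfl⟩ := hπ K k x
    rw [hhom] at hx
    obtain ⟨b, hb⟩ := hcoker L k _ hx
    have hb' : L.d _ k b = f.f k (K.iCycles k z) := by rw [← hcyc, ← hb, htoi]
    suffices ∃ x, K.d ((ComplexShape.up ℕ).prev k) k x = K.iCycles k z by
      obtain ⟨x, hx⟩ := this
      rw [← hi K k ((htoi K _ k x).trans hx), htoπ]
    -- In degree `0` the predecessor `prev 0` is `0` itself, and `d 0 0` vanishes by shape, so the
    -- cocycle is already zero.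
    rcases k with _ | k
    · refine ⟨0, ?_⟩
      rw [L.shape _ _ (by simp)] at hb'
      rw [map_zero]
      exact hf 0 ((map_zero (f.f 0).hom).trans hb')
    · have hk : (ComplexShape.up ℕ).prev (k + 1) = k := by simp
      clear hb
      -- The type of `b` depends on `prev (k + 1)`, which is only propositionally equal to `k`; it
      -- is made a variable so that `subst` can identify the two.
      generalize (ComplexShape.up ℕ).prev (k + 1) = j at hk b hb' ⊢
      subst hk
      obtain ⟨x, b', hx⟩ := h j b _ hb'
      refine ⟨x, hf _ ?_⟩
      rw [hcomm, ← hb', hx, map_add, hdd, add_zero]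
  have h2 : Epi (HomologicalComplex.homologyMap f k) := by
    rw [ModuleCat.epi_iff_surjective]
    intro x
    obtain ⟨z, rfl⟩ := hπ L k x
    -- A cocycle has differential `f 0`. The resulting `x` is a cocycle of `K`, by injectivity of
    -- `f` in degree `k + 1`.
    obtain ⟨x, b, hxb⟩ := h k (L.iCycles k z) 0 (by rw [hid, map_zero])
    obtain ⟨w, rfl⟩ := hker K k x (hf (k + 1) (by
      have := congrArg (L.d k (k + 1)) hxb
      rw [hid, map_add, hdd, add_zero, ← hcomm] at this
      rw [← this, map_zero]))
    refine ⟨K.homologyπ k w, ?_⟩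
    have : z = HomologicalComplex.cyclesMap f k w + L.toCycles _ k b := by
      apply hi
      rw [map_add, hcyc, htoi, hxb]
    rw [hhom, this, map_add, htoπ, add_zero]
  exact isIso_of_mono_of_epi _

end

noncomputable section

namespace DolbeaultKoszul

/-! ### Contraction on exterior powers. -/

section Contraction

variable {W W' : Type*} [AddCommGroup W] [Module ℂ W] [AddCommGroup W'] [Module ℂ W']

/-- By the antiderivation rule `θ ⌟ (w ∧ b) = θ(w) b - w ∧ (θ ⌟ b)`, the degree drops by one as soon
as it does for `b`; scalars are killed. -/
theorem contractLeft_mem_exteriorPower (θ : Module.Dual ℂ W) (i : ℕ) {a : ExteriorAlgebra ℂ W}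
    (ha : a ∈ ⋀[ℂ]^(i + 1) W) :
    CliffordAlgebra.contractLeft (Q := (0 : QuadraticForm ℂ W)) θ a ∈ ⋀[ℂ]^i W := by
  change a ∈ (LinearMap.range (ExteriorAlgebra.ι ℂ (M := W))) ^ (i + 1) at ha
  rw [pow_succ'] at ha
  induction ha using Submodule.mul_induction_on' with
  | add x _ y _ hx hy =>
    rw [map_add]
    exact add_mem hx hy
  | mem_mul_mem x hx b hb =>
    obtain ⟨w, rfl⟩ := hx
    rw [ExteriorAlgebra.ι, CliffordAlgebra.contractLeft_ι_mul]
    refine sub_mem (Submodule.smul_mem _ _ hb) ?_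
    -- The statement under induction is `w ∧ (θ ⌟ b) ∈ ⋀^i` for all `w` and all `b ∈ ⋀^i`. The
    -- factor `w` makes sense of it at `i = 0`, where `θ ⌟ b = 0`.
    induction i generalizing b w with
    | zero =>
      rw [pow_zero] at hb
      obtain ⟨r, rfl⟩ := Submodule.mem_one.1 hb
      rw [CliffordAlgebra.contractLeft_algebraMap, mul_zero]
      exact zero_mem _
    | succ i ih =>
      change _ ∈ (LinearMap.range (ExteriorAlgebra.ι ℂ (M := W))) ^ (i + 1)
      rw [pow_succ']
      refine Submodule.mul_mem_mul (LinearMap.mem_range_self _ w) ?_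
      rw [pow_succ'] at hb
      induction hb using Submodule.mul_induction_on' with
      | add x _ y _ hx hy =>
        rw [map_add]
        exact add_mem hx hy
      | mem_mul_mem x hx b hb =>
        obtain ⟨w, rfl⟩ := hx
        rw [ExteriorAlgebra.ι, CliffordAlgebra.contractLeft_ι_mul]
        refine sub_mem (Submodule.smul_mem _ _ hb) ?_
        apply ih
        exact hb

/-- Contraction `a ↦ θ ⌟ a` of exterior powers with a linear form. -/
def contract (θ : Module.Dual ℂ W) (i : ℕ) : ⋀[ℂ]^(i + 1) W →ₗ[ℂ] ⋀[ℂ]^i W :=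
  (CliffordAlgebra.contractLeft (Q := (0 : QuadraticForm ℂ W)) θ).restrict
    fun _ ha ↦ contractLeft_mem_exteriorPower θ i ha

theorem contract_coe (θ : Module.Dual ℂ W) {i : ℕ} (a : ⋀[ℂ]^(i + 1) W) :
    (contract θ i a : ExteriorAlgebra ℂ W) =
      CliffordAlgebra.contractLeft (Q := (0 : QuadraticForm ℂ W)) θ a := rfl

/-- The antiderivation rule again. Where `θ w = 1`, contraction is a contracting homotopy of the
Koszul complex of `w`. -/
theorem contract_wedgeLeft (θ : Module.Dual ℂ W) (w : W) {i : ℕ} (a : ⋀[ℂ]^(i + 1) W) :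
    contract θ (i + 1) (wedgeLeft w (i + 1) a) + wedgeLeft w i (contract θ i a) = θ w • a := by
  apply Subtype.ext
  rw [Submodule.coe_add, contract_coe, wedgeLeft_coe, wedgeLeft_coe, contract_coe,
    ExteriorAlgebra.ι, CliffordAlgebra.contractLeft_ι_mul]
  exact sub_add_cancel _ _

/-- The bottom of the Koszul complex: the second term of the homotopy identity is absent, since
contraction kills scalars. -/
theorem contract_wedgeLeft_zero (θ : Module.Dual ℂ W) (w : W) (a : ⋀[ℂ]^0 W) :
    contract θ 0 (wedgeLeft w 0 a) = θ w • a := by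
  obtain ⟨a, ha⟩ := a
  apply Subtype.ext
  rw [contract_coe, wedgeLeft_coe, ExteriorAlgebra.ι, CliffordAlgebra.contractLeft_ι_mul]
  change a ∈ (LinearMap.range (ExteriorAlgebra.ι ℂ (M := W))) ^ 0 at ha
  rw [pow_zero] at ha
  obtain ⟨r, rfl⟩ := Submodule.mem_one.1 ha
  rw [CliffordAlgebra.contractLeft_algebraMap, mul_zero, sub_zero]
  rfl

/-- Naturality, checked on the whole exterior algebra, where `⋀ g` is an algebra map and induction
on left products by vectors applies. It carries contraction from the fibres of `V` to a frame. -/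
theorem contract_map (g : W →ₗ[ℂ] W') (θ : Module.Dual ℂ W') {i : ℕ} (a : ⋀[ℂ]^(i + 1) W) :
    exteriorPower.map i g (contract (θ ∘ₗ g) i a) =
      contract θ i (exteriorPower.map (i + 1) g a) := by
  have coe_map (j : ℕ) (b : ⋀[ℂ]^j W) : (exteriorPower.map j g b : ExteriorAlgebra ℂ W') =
      ExteriorAlgebra.map g b := by
    have : (⋀[ℂ]^j W').subtype ∘ₗ exteriorPower.map j g =
        (ExteriorAlgebra.map g).toLinearMap ∘ₗ (⋀[ℂ]^j W).subtype := by
      apply exteriorPower.linearMap_ext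
      ext v
      simp [ExteriorAlgebra.map_apply_ιMulti]
    exact congrArg (fun T ↦ T b) this
  apply Subtype.ext
  rw [coe_map, contract_coe, contract_coe, coe_map]
  generalize (a : ExteriorAlgebra ℂ W) = b
  induction b using CliffordAlgebra.left_induction with
  | algebraMap r =>
    rw [CliffordAlgebra.contractLeft_algebraMap, map_zero, AlgHom.commutes,
      CliffordAlgebra.contractLeft_algebraMap]
  | add x y hx hy => simp only [map_add, hx, hy]
  | ι_mul x w hx =>
    have h1 : ExteriorAlgebra.map g (CliffordAlgebra.ι 0 w) = CliffordAlgebra.ι 0 (g w) :=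
      ExteriorAlgebra.map_apply_ι g w
    rw [CliffordAlgebra.contractLeft_ι_mul, map_sub, map_smul, map_mul, map_mul, h1, hx,
      CliffordAlgebra.contractLeft_ι_mul]
    rfl

theorem contract_add (θ θ' : Module.Dual ℂ W) {i : ℕ} (a : ⋀[ℂ]^(i + 1) W) :
    contract (θ + θ') i a = contract θ i a + contract θ' i a := by
  apply Subtype.ext
  simp [contract_coe]

theorem contract_smul (c : ℂ) (θ : Module.Dual ℂ W) {i : ℕ} (a : ⋀[ℂ]^(i + 1) W) :
    contract (c • θ) i a = c • contract θ i a := by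
  apply Subtype.ext
  simp [contract_coe]

variable {F : Type*} [NormedAddCommGroup F] [NormedSpace ℂ F] [FiniteDimensional ℂ F]

/-- Contraction in the coordinates of `frameEquiv`. -/
def frameContract (i : ℕ) : (F →L[ℂ] ℂ) →L[ℂ] FrameSpace F (i + 1) →L[ℂ] FrameSpace F i :=
  LinearMap.toContinuousLinearMap
    { toFun := fun θ ↦ LinearMap.toContinuousLinearMap ((frameEquiv F i).toLinearMap ∘ₗ
        contract (θ : F →ₗ[ℂ] ℂ) i ∘ₗ (frameEquiv F (i + 1)).symm.toLinearMap)
      map_add' := fun θ θ' ↦ by ext1 a; simp [contract_add]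
      map_smul' := fun c θ ↦ by ext1 a; simp [contract_smul] }

theorem frameContract_apply (i : ℕ) (θ : F →L[ℂ] ℂ) (a : FrameSpace F (i + 1)) :
    frameContract i θ a =
      frameEquiv F i (contract (θ : F →ₗ[ℂ] ℂ) i ((frameEquiv F (i + 1)).symm a)) := rfl

end Contraction

/-! ### From complex to real differentiability. -/

section RestrictScalars

variable {E : Type*} [NormedAddCommGroup E] [NormedSpace ℂ E]
  {X : Type*} [NormedAddCommGroup X] [NormedSpace ℂ X]
  {M : Type*} [TopologicalSpace M] [ChartedSpace E M]

theorem contMDiffAt_restrictScalars {r : WithTop ℕ∞} {f : M → X} {x : M}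
    (hf : ContMDiffAt 𝓘(ℂ, E) 𝓘(ℂ, X) r f x) : ContMDiffAt 𝓘(ℝ, E) 𝓘(ℝ, X) r f x := by
  rw [contMDiffAt_iff] at hf ⊢
  exact ⟨hf.1, hf.2.restrict_scalars ℝ⟩

/-- The same atlas serves over `ℝ`. Smooth partitions of unity live on this real manifold. -/
theorem isManifold_restrictScalars (r : WithTop ℕ∞) [IsManifold 𝓘(ℂ, E) r M] :
    IsManifold 𝓘(ℝ, E) r M := by
  refine isManifold_of_contDiffOn _ _ _ fun e e' he he' ↦ ?_
  have h := (contDiffGroupoid r 𝓘(ℂ, E)).compatible he he'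
  exact ((contDiffGroupoid r 𝓘(ℂ, E)).mem_iff_of_eqOnSource (Setoid.refl _) |>.1 h).1.restrict_scalars ℝ

end RestrictScalars

/-! ### A smooth section of the dual bundle equal to one on `s` off a compact set. -/

section DualSection

open Bundle

set_option linter.unusedSectionVars false

variable {E : Type*} [NormedAddCommGroup E] [NormedSpace ℂ E] [FiniteDimensional ℂ E]
  {F : Type*} [NormedAddCommGroup F] [NormedSpace ℂ F] [FiniteDimensional ℂ F]
  {M : Type*} [TopologicalSpace M] [ChartedSpace E M] [IsManifold 𝓘(ℂ, E) ω M]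
  {V : M → Type*} [TopologicalSpace (TotalSpace F V)] [∀ x, AddCommGroup (V x)]
  [∀ x, Module ℂ (V x)] [∀ x, TopologicalSpace (V x)] [FiberBundle F V] [VectorBundle ℂ F V]

variable (F) in
/-- The local representative at `x`, in the frame at `x₀`, of a section of the dual bundle. -/
def dualRep (θ : ∀ x, Module.Dual ℂ (V x)) (x₀ x : M) : F →L[ℂ] ℂ :=
  LinearMap.toContinuousLinearMap (θ x ∘ₗ (trivializationAt F V x₀).symmₗ ℂ x)

theorem dualRep_apply (θ : ∀ x, Module.Dual ℂ (V x)) (x₀ x : M) (w : F) :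
    dualRep F θ x₀ x w = θ x ((trivializationAt F V x₀).symmₗ ℂ x w) := rfl

theorem dualRep_comp_linearMapAt (θ : ∀ x, Module.Dual ℂ (V x)) {x₀ x : M}
    (h : x ∈ (trivializationAt F V x₀).baseSet) :
    (dualRep F θ x₀ x : F →ₗ[ℂ] ℂ) ∘ₗ (trivializationAt F V x₀).linearMapAt ℂ x = θ x := by
  ext w
  exact congrArg (θ x) ((trivializationAt F V x₀).symmₗ_linearMapAt h w)

variable (E F) in
/-- Smoothness at `x` of a section of the dual bundle. -/
def SmoothDualAt (θ : ∀ x, Module.Dual ℂ (V x)) (x : M) : Prop :=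
  ∀ x₀, x ∈ (trivializationAt F V x₀).baseSet →
    ContMDiffAt 𝓘(ℝ, E) 𝓘(ℝ, F →L[ℂ] ℂ) ∞ (dualRep F θ x₀) x

theorem SmoothDualAt.contDiffAt {θ : ∀ x, Module.Dual ℂ (V x)} (hθ : ∀ x, SmoothDualAt E F θ x)
    {x₀ : M} {y : E} (hy : y ∈ localDomain E F V x₀) :
    ContDiffAt ℝ ∞ (fun z ↦ dualRep F θ x₀ ((extChartAt 𝓘(ℂ, E) x₀).symm z)) y := by
  have : IsManifold 𝓘(ℝ, E) ω M := isManifold_restrictScalars ω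
  rw [← contMDiffAt_iff_contDiffAt]
  have h : ContMDiffAt 𝓘(ℝ, E) 𝓘(ℝ, E) ∞ (extChartAt 𝓘(ℂ, E) x₀).symm y :=
    ((contMDiffOn_extChartAt_symm (I := 𝓘(ℝ, E)) (n := ω) x₀).contMDiffAt
      ((isOpen_extChartAt_target x₀).mem_nhds hy.1)).of_le le_top
  exact (hθ _ x₀ hy.2).comp y h

variable [ContMDiffVectorBundle ω F V 𝓘(ℂ, E)]

theorem contMDiffAt_linearMapAt_section (s : Cₛ^ω⟮𝓘(ℂ, E); F, V⟯) {x₀ x : M}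
    (hx : x ∈ (trivializationAt F V x₀).baseSet) :
    ContMDiffAt 𝓘(ℂ, E) 𝓘(ℂ, F) ω
      (fun z ↦ (trivializationAt F V x₀).linearMapAt ℂ z (s z)) x := by
  refine (((trivializationAt F V x₀).contMDiffAt_section_iff (IB := 𝓘(ℂ, E)) (n := ω)
    (s := s) hx).1 s.contMDiff.contMDiffAt).congr_of_eventuallyEq ?_
  filter_upwards [(trivializationAt F V x₀).open_baseSet.mem_nhds hx] with z hz
  rw [Trivialization.coe_linearMapAt_of_mem _ hz]

/-- In a frame at `x₁`, take a constant linear form `l` with `l(s) ≠ 0` at `x₁` and normalise it to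
`l / l(s)` on the open set where `l(s)` does not vanish. -/
theorem exists_local_dual (s : Cₛ^ω⟮𝓘(ℂ, E); F, V⟯) {x₁ : M} (hx₁ : s x₁ ≠ 0) :
    ∃ (U : Set M) (θ : ∀ x, Module.Dual ℂ (V x)), IsOpen U ∧ x₁ ∈ U ∧
      ∀ x ∈ U, SmoothDualAt E F θ x ∧ θ x (s x) = 1 := by
  set e := trivializationAt F V x₁ with he
  have hb : x₁ ∈ e.baseSet := mem_baseSet_trivializationAt F V x₁
  have hne : e.linearMapAt ℂ x₁ (s x₁) ≠ 0 := fun h ↦ hx₁ (by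
    rw [← e.symmₗ_linearMapAt (R := ℂ) hb (s x₁), h, map_zero])
  obtain ⟨l, hl⟩ := SeparatingDual.exists_ne_zero (R := ℂ) hne
  let g : M → ℂ := fun x ↦ l (e.linearMapAt ℂ x (s x))
  have hg (x : M) (hx : x ∈ e.baseSet) : ContMDiffAt 𝓘(ℂ, E) 𝓘(ℂ, ℂ) ω g x :=
    l.contMDiff.contMDiffAt.comp x (contMDiffAt_linearMapAt_section s hx)
  refine ⟨e.baseSet ∩ g ⁻¹' {0}ᶜ, fun x ↦ (g x)⁻¹ • ((l : F →ₗ[ℂ] ℂ) ∘ₗ e.linearMapAt ℂ x),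
    ContinuousOn.isOpen_inter_preimage (fun x hx ↦ (hg x hx).continuousAt.continuousWithinAt)
      e.open_baseSet isOpen_compl_singleton, ⟨hb, hl⟩, ?_⟩
  rintro x ⟨hx, hgx⟩
  refine ⟨fun x₀ hx₀ ↦ contMDiffAt_restrictScalars ?_, inv_mul_cancel₀ hgx⟩
  -- In another frame `x₀` the form reads `g⁻¹ • l` composed with the transition function from `x₀`
  -- to `x₁`, so it is holomorphic there too.
  have h1 : ContMDiffAt 𝓘(ℂ, E) 𝓘(ℂ, F →L[ℂ] F) ω (fun z ↦
      ((trivializationAt F V x₀).coordChangeL ℂ e z : F →L[ℂ] F)) x :=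
    contMDiffAt_coordChangeL hx₀ hx
  have h2 : ContMDiffAt 𝓘(ℂ, E) 𝓘(ℂ, F →L[ℂ] ℂ) ω (fun z ↦ (g z)⁻¹ • l ∘L
      ((trivializationAt F V x₀).coordChangeL ℂ e z : F →L[ℂ] F)) x := by
    refine ContMDiffAt.smul ((contDiffAt_inv ℂ hgx).contMDiffAt.comp x (hg x hx)) ?_
    exact (ContinuousLinearMap.compL ℂ F F ℂ l).contMDiff.contMDiffAt.comp x h1
  refine (h2.of_le le_top).congr_of_eventuallyEq ?_
  filter_upwards [(trivializationAt F V x₀).open_baseSet.mem_nhds hx₀,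
    e.open_baseSet.mem_nhds hx] with z hz hz'
  ext w
  simp [dualRep_apply, Trivialization.coordChangeL_apply, hz, hz', Trivialization.symmₗ_apply]

/-- The condition `θ(s) = 1` is affine in `θ`, so it survives averaging local solutions with a
partition of unity. On the interior of `K` nothing is required, and `θ = 0` serves near the zeros of
`s`. -/
theorem exists_dual_eq_one_off_compact [T2Space M] [SecondCountableTopology M]
    (s : Cₛ^ω⟮𝓘(ℂ, E); F, V⟯) (hZ : IsCompact {x | s x = 0}) :
    ∃ θ : ∀ x, Module.Dual ℂ (V x), (∀ x, SmoothDualAt E F θ x) ∧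
      ∃ K : Set M, IsCompact K ∧ ∀ x ∉ K, θ x (s x) = 1 := by
  have : IsManifold 𝓘(ℝ, E) ω M := isManifold_restrictScalars ω
  have : IsManifold 𝓘(ℝ, E) ∞ M := .of_le le_top
  have : FiniteDimensional ℝ E := FiniteDimensional.complexToReal E
  have : ProperSpace E := FiniteDimensional.proper ℝ E
  have : LocallyCompactSpace M := ChartedSpace.locallyCompactSpace E M
  -- `K` is a compact neighbourhood of the zero locus, available because `M` is locally compact.
  obtain ⟨K, hK, hZK⟩ := exists_compact_superset hZ
  have hloc (x₁ : M) : ∃ (U : Set M) (θ : ∀ x, Module.Dual ℂ (V x)), IsOpen U ∧ x₁ ∈ U ∧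
      ∀ x ∈ U, SmoothDualAt E F θ x ∧ (x ∉ K → θ x (s x) = 1) := by
    by_cases h : s x₁ = 0
    · refine ⟨interior K, 0, isOpen_interior, hZK h, fun x hx ↦ ⟨fun x₀ _ ↦ ?_,
        fun hx' ↦ absurd (interior_subset hx) hx'⟩⟩
      have : dualRep F (0 : ∀ x, Module.Dual ℂ (V x)) x₀ = fun _ ↦ 0 := rfl
      rw [this]
      exact contMDiffAt_const
    · obtain ⟨U, θ, hU, hx, hθ⟩ := exists_local_dual s h
      exact ⟨U, θ, hU, hx, fun x hx ↦ ⟨(hθ x hx).1, fun _ ↦ (hθ x hx).2⟩⟩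
  choose U θ hU hxU hθ using hloc
  obtain ⟨ρ, hρ⟩ := SmoothPartitionOfUnity.exists_isSubordinate 𝓘(ℝ, E) isClosed_univ U hU
    fun x _ ↦ Set.mem_iUnion_of_mem x (hxU x)
  have hfin (x : M) : (Function.support fun a ↦ ρ a x).Finite := ρ.locallyFinite.point_finite x
  have hsub (x : M) : (Function.support fun a ↦ ((ρ a x : ℝ) : ℂ) • θ a x) ⊆ (hfin x).toFinset :=
    fun a ha ↦ by
      simp only [Set.Finite.coe_toFinset, Function.mem_support] at ha ⊢
      exact fun h ↦ ha (by rw [h, Complex.ofReal_zero, zero_smul])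
  refine ⟨fun x ↦ ∑ᶠ a, ((ρ a x : ℝ) : ℂ) • θ a x, fun x x₀ hx ↦ ?_, K, hK, fun x hx ↦ ?_⟩
  -- Smoothness of `θ a` at `x` is needed only when `x` lies in the closed support of `ρ a`, hence
  -- in `U a`.
  · have h := ρ.contMDiffAt_finsum (n := ⊤) (x₀ := x) (g := fun a ↦ dualRep F (θ a) x₀)
      fun a ha ↦ (hθ a x (hρ a ha)).1 x₀ hx
    refine h.congr_of_eventuallyEq (.of_forall fun z ↦ ?_)
    ext w
    have hsub' : (Function.support fun a ↦ ρ a z • dualRep F (θ a) x₀ z) ⊆ (hfin z).toFinset :=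
      fun a ha ↦ by
        simp only [Set.Finite.coe_toFinset, Function.mem_support] at ha ⊢
        exact fun h ↦ ha (by ext v; simp [h])
    simp only [dualRep_apply]
    rw [finsum_eq_sum_of_support_subset _ (hsub z), finsum_eq_sum_of_support_subset _ hsub']
    simp [dualRep_apply]
  · simp only
    rw [finsum_eq_sum_of_support_subset _ (hsub x), LinearMap.sum_apply]
    have h1 := ρ.sum_eq_one (Set.mem_univ x)
    rw [finsum_eq_sum_of_support_subset (s := (hfin x).toFinset) _ (by simp)] at h1
    have h2 : ∀ a ∈ (hfin x).toFinset, (((ρ a x : ℝ) : ℂ) • θ a x) (s x) = (ρ a x : ℝ) := by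
      intro a ha
      rw [Set.Finite.mem_toFinset] at ha
      rw [LinearMap.smul_apply, (hθ a x (hρ a (subset_tsupport _ ha))).2 hx, smul_eq_mul, mul_one]
    rw [Finset.sum_congr rfl h2, ← Complex.ofReal_sum, h1, Complex.ofReal_one]

end DualSection

/-- A counterpart of `contDiffAt_clm_comp` with coefficients differentiable only over `ℝ`, as
contraction with the glued `θ` requires. -/
theorem contDiffAt_restrictScalars_clm_comp {E G G' : Type*} [NormedAddCommGroup E]
    [NormedSpace ℂ E] [NormedAddCommGroup G] [NormedSpace ℂ G] [NormedAddCommGroup G']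
    [NormedSpace ℂ G'] {m : ℕ} {r : WithTop ℕ∞} {L : E → G →L[ℂ] G'}
    {η : E → E [⋀^Fin m]→L[ℝ] G} {y : E} (hL : ContDiffAt ℝ r L y) (hη : ContDiffAt ℝ r η y) :
    ContDiffAt ℝ r
      (fun z ↦ ((L z).restrictScalars ℝ).compContinuousAlternatingMap (η z)) y := by
  have h1 : ContDiffAt ℝ r (fun z ↦ (L z).restrictScalars ℝ) y :=
    (ContinuousLinearMap.restrictScalarsL ℂ G G' ℝ ℝ).contDiff.contDiffAt.comp y hL
  have h2 : ContDiffAt ℝ r (fun z ↦ ContinuousLinearMap.compContinuousAlternatingMapCLM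
      (ι := Fin m) ℝ E G G' ((L z).restrictScalars ℝ)) y :=
    (ContinuousLinearMap.contDiff _).contDiffAt.comp y h1
  exact h2.clm_apply hη

/-! ### The homotopy on forms and the descent on exterior degree. -/

section Homotopy

open Bundle CategoryTheory

set_option linter.unusedSectionVars false

variable {E : Type*} [NormedAddCommGroup E] [NormedSpace ℂ E] [FiniteDimensional ℂ E]
  {F : Type*} [NormedAddCommGroup F] [NormedSpace ℂ F] [FiniteDimensional ℂ F]
  {M : Type*} [TopologicalSpace M] [ChartedSpace E M] [IsManifold 𝓘(ℂ, E) ω M]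
  {V : M → Type*} [TopologicalSpace (TotalSpace F V)] [∀ x, AddCommGroup (V x)]
  [∀ x, Module ℂ (V x)] [∀ x, TopologicalSpace (V x)] [FiberBundle F V] [VectorBundle ℂ F V]

/-- The contraction of a field of forms with a section of the dual bundle, with the sign that makes
it a graded derivation. -/
def contractAt {m i : ℕ} (θ : ∀ x, Module.Dual ℂ (V x)) (α : ∀ x, FormAt E V m (i + 1) x) (x : M) :
    FormAt E V m i x :=
  (-1 : ℂ) ^ m • ((contract (θ x) i).restrictScalars ℝ).compAlternatingMap (α x)

theorem toFrame_contract {i : ℕ} (θ : ∀ x, Module.Dual ℂ (V x)) {x₀ x : M}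
    (h : x ∈ (trivializationAt F V x₀).baseSet) (a : ⋀[ℂ]^(i + 1) (V x)) :
    toFrame F V i x₀ x (contract (θ x) i a) =
      frameContract i (dualRep F θ x₀ x) (toFrame F V (i + 1) x₀ x a) := by
  conv_lhs => rw [← dualRep_comp_linearMapAt (F := F) θ h]
  simp [toFrame, contract_map, frameContract_apply]

theorem localRep_contractAt {m i : ℕ} (θ : ∀ x, Module.Dual ℂ (V x))
    (α : ∀ x, FormAt E V m (i + 1) x) {x₀ : M} {y : E} (hy : y ∈ localDomain E F V x₀) :
    localRep F x₀ (contractAt θ α) y = (((-1 : ℂ) ^ m • frameContract i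
      (dualRep F θ x₀ ((extChartAt 𝓘(ℂ, E) x₀).symm y))).restrictScalars
        ℝ).compContinuousAlternatingMap (localRep F x₀ α y) := by
  ext1 v
  rw [localRep, coordsAt_apply]
  change toFrame F V i x₀ _ ((-1 : ℂ) ^ m • contract _ i (α _ _)) = _
  rw [map_smul, toFrame_contract θ hy.2]
  rfl

variable [ContMDiffVectorBundle ω F V 𝓘(ℂ, E)]

theorem contractAt_mem {θ : ∀ x, Module.Dual ℂ (V x)} (hθ : ∀ x, SmoothDualAt E F θ x)
    {p q i : ℕ} {α : ∀ x, FormAt E V (p + q) (i + 1) x} (hα : α ∈ forms E F V p q (i + 1)) :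
    contractAt θ α ∈ forms E F V p q i := by
  refine ⟨fun x₀ y hy ↦ ?_, fun x c v ↦ ?_⟩
  · have hy' := (isOpen_localDomain x₀).mem_nhds hy
    refine ContDiffAt.contDiffWithinAt ?_
    have h1 : ContDiffAt ℝ ∞ (fun z ↦ (-1 : ℂ) ^ (p + q) • frameContract i
        (dualRep F θ x₀ ((extChartAt 𝓘(ℂ, E) x₀).symm z))) y :=
      (((frameContract (F := F) i).restrictScalars ℝ).contDiff.contDiffAt.comp y
        (SmoothDualAt.contDiffAt hθ hy)).const_smul _
    refine (contDiffAt_restrictScalars_clm_comp h1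
      ((hα.1 x₀).contDiffAt hy')).congr_of_eventuallyEq ?_
    filter_upwards [hy'] with z hz
    exact localRep_contractAt θ α hz
  · have := hα.2 x c v
    simp only [contractAt, AlternatingMap.smul_apply, LinearMap.compAlternatingMap_apply,
      LinearMap.coe_restrictScalars, this, map_smul]
    rw [smul_comm]

/-- Contraction of forms with a smooth section of the dual bundle. -/
def contractSection {θ : ∀ x, Module.Dual ℂ (V x)} (hθ : ∀ x, SmoothDualAt E F θ x)
    (p q i : ℕ) (α : forms E F V p q (i + 1)) : forms E F V p q i :=
  ⟨contractAt θ α.1, contractAt_mem hθ α.2⟩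

theorem mem_compactForms_of_eq_zero [T2Space M] {p q i : ℕ} {α : forms E F V p q i} {K : Set M}
    (hK : IsCompact K) (h : ∀ x ∉ K, α.1 x = 0) : α ∈ compactForms E F V p q i :=
  hK.of_isClosed_subset isClosed_closure (closure_minimal
    (fun x hx ↦ by_contra fun hxK ↦ hx (h x hxK)) hK.isClosed)

theorem contractSection_mem_compactForms {θ : ∀ x, Module.Dual ℂ (V x)}
    (hθ : ∀ x, SmoothDualAt E F θ x) {p q i : ℕ} {α : forms E F V p q (i + 1)}
    (hα : α ∈ compactForms E F V p q (i + 1)) :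
    contractSection hθ p q i α ∈ compactForms E F V p q i := by
  refine hα.of_isClosed_subset isClosed_closure (closure_mono fun x hx h ↦ hx ?_)
  change contractAt θ α.1 x = 0
  rw [contractAt, h]
  ext v
  simp

/-- Neither operator changes the form degree `m`, so the signs `(-1) ^ m` occur in pairs and cancel,
leaving the fibrewise Koszul identity. -/
theorem contractAt_wedgeAt {θ : ∀ x, Module.Dual ℂ (V x)} {s : ∀ x, V x} {m i : ℕ}
    (α : ∀ x, FormAt E V m (i + 1) x) (x : M) :
    contractAt θ (wedgeAt s α) x + wedgeAt s (contractAt θ α) x = θ x (s x) • α x := by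
  have h : (-1 : ℂ) ^ m * (-1) ^ m = 1 := by rw [← mul_pow]; simp
  ext1 v
  change (-1 : ℂ) ^ m • contract (θ x) (i + 1) ((-1 : ℂ) ^ m • wedgeLeft (s x) (i + 1) (α x v)) +
    (-1 : ℂ) ^ m • wedgeLeft (s x) i ((-1 : ℂ) ^ m • contract (θ x) i (α x v)) =
      θ x (s x) • α x v
  rw [map_smul, map_smul, smul_smul, smul_smul, h, one_smul, one_smul]
  exact contract_wedgeLeft (θ x) (s x) (α x v)

theorem contractAt_wedgeAt_zero {θ : ∀ x, Module.Dual ℂ (V x)} {s : ∀ x, V x} {m : ℕ}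
    (α : ∀ x, FormAt E V m 0 x) (x : M) :
    contractAt θ (wedgeAt s α) x = θ x (s x) • α x := by
  have h : (-1 : ℂ) ^ m * (-1) ^ m = 1 := by rw [← mul_pow]; simp
  ext1 v
  change (-1 : ℂ) ^ m • contract (θ x) 0 ((-1 : ℂ) ^ m • wedgeLeft (s x) 0 (α x v)) =
      θ x (s x) • α x v
  rw [map_smul, smul_smul, h, one_smul]
  exact contract_wedgeLeft_zero (θ x) (s x) (α x v)

/-- Contraction of all components with a smooth section of the dual bundle. -/
def contractPart {θ : ∀ x, Module.Dual ℂ (V x)} (hθ : ∀ x, SmoothDualAt E F θ x) {p : ℕ}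
    (α : DoubleComplex E F V p) : DoubleComplex E F V p :=
  fun i j ↦ contractSection hθ p j i (α (i + 1) j)

/-- With `h` the contraction, `α - s ∧ h α = (1 - θ(s)) α + h (s ∧ α)`. The first term vanishes off
`K`, and the second has compact support because `s ∧ α` does. -/
theorem sub_wedgePart_contractPart_mem [T2Space M] {θ : ∀ x, Module.Dual ℂ (V x)}
    (hθ : ∀ x, SmoothDualAt E F θ x) (s : Cₛ^ω⟮𝓘(ℂ, E); F, V⟯) {K : Set M} (hK : IsCompact K)
    (hs : ∀ x ∉ K, θ x (s x) = 1) {p : ℕ} (α : DoubleComplex E F V p) (i j : ℕ)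
    (hα : wedgeSection s p j i (α i j) ∈ compactForms E F V p j (i + 1)) :
    α i j - wedgePart s (contractPart hθ α) i j ∈ compactForms E F V p j i := by
  have h := contractSection_mem_compactForms hθ hα
  rw [← sub_add_cancel (α i j - wedgePart s (contractPart hθ α) i j)
    (contractSection hθ p j i (wedgeSection s p j i (α i j)))]
  refine add_mem (mem_compactForms_of_eq_zero hK fun x hx ↦ ?_) h
  -- For `i = 0` the `s ∧` component is zero by definition, and the identity reduces to `h (s ∧ α) =
  -- θ(s) α`.
  rcases i with _ | i
  · change (α 0 j).1 x - 0 - contractAt θ (wedgeAt s (α 0 j).1) x = 0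
    have e := contractAt_wedgeAt_zero (θ := θ) (s := s) (α 0 j).1 x
    rw [hs x hx, one_smul] at e
    have key {G : Type _} [AddCommGroup G] (a b : G) (hab : b = a) : a - 0 - b = 0 := by
      rw [hab, sub_zero, sub_self]
    exact key _ _ e
  · change (α (i + 1) j).1 x - wedgeAt s (contractAt θ (α (i + 1) j).1) x -
      contractAt θ (wedgeAt s (α (i + 1) j).1) x = 0
    have e := contractAt_wedgeAt (θ := θ) (s := s) (α (i + 1) j).1 x
    rw [hs x hx, one_smul] at e
    have key {G : Type _} [AddCommGroup G] (a b c : G) (h : b + c = a) : a - c - b = 0 := by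
      rw [← h, add_sub_cancel_right, sub_self]
    exact key (G := FormAt E V (p + j) (i + 1) x) _ _ _ e

/-- Each correction by `∂̄_s` of a contraction makes one more row compactly supported; `N` counts
the rows still to be treated. Writing the degree of `β` as `i + j + 1 = k` avoids truncated
subtraction and forces `β = 0` when `k = 0`. -/
theorem exists_sub_dbarS_mem_compactForms [T2Space M] {θ : ∀ x, Module.Dual ℂ (V x)}
    (hθ : ∀ x, SmoothDualAt E F θ x) (s : Cₛ^ω⟮𝓘(ℂ, E); F, V⟯) {K : Set M} (hK : IsCompact K)
    (hs : ∀ x ∉ K, θ x (s x) = 1) (p k N : ℕ) (γ : DoubleComplex E F V p)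
    (hk : ∀ i j, i + j ≠ k → γ i j = 0)
    (hN : ∀ i j, N ≤ i → γ i j ∈ compactForms E F V p j i)
    (hγ : ∀ i j, dbarS s p γ i j ∈ compactForms E F V p j i) :
    ∃ β : DoubleComplex E F V p, (∀ i j, i + j + 1 ≠ k → β i j = 0) ∧
      ∀ i j, (γ - dbarS s p β) i j ∈ compactForms E F V p j i := by
  induction N generalizing γ with
  | zero =>
    refine ⟨0, fun _ _ _ ↦ rfl, fun i j ↦ ?_⟩
    rw [map_zero, sub_zero]
    exact hN i j (Nat.zero_le i)
  | succ N ih =>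
    have hH (i j : ℕ) (h : i + j + 1 ≠ k) : contractPart hθ γ i j = 0 := by
      rw [contractPart, hk (i + 1) j (by omega)]
      apply Subtype.ext
      funext x
      ext1 v
      change (-1 : ℂ) ^ (p + j) • contract (θ x) i 0 = 0
      rw [map_zero, smul_zero]
    have hHc (i j : ℕ) (h : N ≤ i) : contractPart hθ γ i j ∈ compactForms E F V p j i :=
      contractSection_mem_compactForms hθ (hN (i + 1) j (by omega))
    have hdH (i j : ℕ) (h : N ≤ i) :
        dbarPart (contractPart hθ γ) i j ∈ compactForms E F V p j i := by
      rcases j with _ | j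
      · exact zero_mem _
      · exact dbar_mem_compactForms (hHc i j h)
    -- In row `i + 1`, `s ∧ γ` is `∂̄_s γ` minus `∂̄ γ`: the former is compactly supported by
    -- assumption, the latter because row `i + 1 ≥ N + 1` of `γ` is.
    have hw (i j : ℕ) (h : N ≤ i) :
        wedgeSection s p j i (γ i j) ∈ compactForms E F V p j (i + 1) := by
      have h1 : dbarPart γ (i + 1) j ∈ compactForms E F V p j (i + 1) := by
        rcases j with _ | j
        · exact zero_mem _
        · exact dbar_mem_compactForms (hN (i + 1) j (by omega))
      have h2 := sub_mem (hγ (i + 1) j) h1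
      rwa [dbarS_apply, add_sub_cancel_left] at h2
    obtain ⟨β, hβ, hβ'⟩ := ih (γ - dbarS s p (contractPart hθ γ)) (fun i j h ↦ by
        change γ i j - dbarS s p (contractPart hθ γ) i j = 0
        rw [hk i j h, zero_sub, neg_eq_zero, dbarS_apply]
        have h1 : dbarPart (contractPart hθ γ) i j = 0 := by
          rcases j with _ | j
          · rfl
          · exact (congrArg (dbar E F V p j i) (hH i j (by omega))).trans (map_zero _)
        have h2 : wedgePart s (contractPart hθ γ) i j = 0 := by
          rcases i with _ | i
          · rfl
          · exact (congrArg (wedgeSection s p j i) (hH i j (by omega))).trans (map_zero _)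
        rw [h1, h2, add_zero])
      (fun i j h ↦ by
        change γ i j - (dbarPart (contractPart hθ γ) i j + wedgePart s (contractPart hθ γ) i j) ∈ _
        have e (a b c : forms E F V p j i) : a - (b + c) = a - c - b := by abel
        rw [e]
        exact sub_mem (sub_wedgePart_contractPart_mem hθ s hK hs γ i j (hw i j h)) (hdH i j h))
      -- Since `∂̄_s² = 0`, the correction leaves `∂̄_s γ` unchanged, so the induction hypothesis
      -- still applies.
      (fun i j ↦ by
        rw [map_sub, dbarS_dbarS, sub_zero]
        exact hγ i j)
    refine ⟨contractPart hθ γ + β, fun i j h ↦ ?_, fun i j ↦ ?_⟩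
    · rw [DoubleComplex.add_apply, hH i j h, hβ i j h, add_zero]
    · rw [map_add, ← sub_sub]
      exact hβ' i j

theorem quasiIso_inclusionEc [T2Space M] [SecondCountableTopology M]
    (s : Cₛ^ω⟮𝓘(ℂ, E); F, V⟯) (hZ : IsCompact {x | s x = 0}) (p : ℕ) :
    QuasiIso (inclusionEc s p) := by
  obtain ⟨θ, hθ, K, hK, hs⟩ := exists_dual_eq_one_off_compact s hZ
  refine quasiIso_of_injective_of_forall_exists _
    (fun k x y hxy ↦ Subtype.ext
      (congrArg (fun z : totalDegree E F V p k ↦ z.1) hxy)) fun k y c hyc ↦ ?_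
  rw [complexE_d] at hyc
  have hyc' : dbarS s p y.1 = c.1 := congrArg Subtype.val hyc
  -- The descent starts at `N = k + 1`: rows with `i ≥ k + 1` vanish in total degree `k`.
  obtain ⟨β, hβ, hβ'⟩ := exists_sub_dbarS_mem_compactForms hθ s hK hs p k (k + 1) y.1 y.2
    (fun i j h ↦ by
      rw [y.2 i j (by omega)]
      exact zero_mem _)
    (fun i j ↦ by
      rw [hyc']
      exact c.2.2 i j)
  have hd : dbarS s p β ∈ totalDegree E F V p k := by
    rcases k with _ | k
    · have : β = 0 := funext fun i ↦ funext fun j ↦ hβ i j (by omega)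
      rw [this, map_zero]
      exact zero_mem _
    · exact dbarS_mem s p k fun i j h ↦ hβ i j (by omega)
  refine ⟨⟨y.1 - dbarS s p β, sub_mem y.2 hd, hβ'⟩, ?_⟩
  -- In degree `0` there is no preceding term: `β = 0`, and the primitive asked for in `prev 0 = 0`
  -- is taken to be zero.
  rcases k with _ | k
  · have : β = 0 := funext fun i ↦ funext fun j ↦ hβ i j (by omega)
    refine ⟨0, Subtype.ext ?_⟩
    rw [map_zero, add_zero]
    change y.1 = y.1 - dbarS s p β
    rw [this, map_zero, sub_zero]
  · have hk : (ComplexShape.up ℕ).prev (k + 1) = k := by simp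
    rw [hk]
    refine ⟨⟨β, fun i j h ↦ hβ i j (by omega)⟩, Subtype.ext ?_⟩
    rw [complexE_d]
    exact (sub_add_cancel y.1 (dbarS s p β)).symm

end Homotopy

end DolbeaultKoszul

end

theorem mainTheorem3 {n : ℕ}
    {E : Type*} [NormedAddCommGroup E] [NormedSpace ℂ E] [FiniteDimensional ℂ E]
    {F : Type*} [NormedAddCommGroup F] [NormedSpace ℂ F] [FiniteDimensional ℂ F]
    (hE : Module.finrank ℂ E = n) (hF : Module.finrank ℂ F = n)
    {M : Type*} [TopologicalSpace M] [T2Space M] [SecondCountableTopology M]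
    [ChartedSpace E M] [IsManifold 𝓘(ℂ, E) ω M]
    {V : M → Type*} [TopologicalSpace (Bundle.TotalSpace F V)] [∀ x, AddCommGroup (V x)]
    [∀ x, Module ℂ (V x)] [∀ x, TopologicalSpace (V x)] [FiberBundle F V] [VectorBundle ℂ F V]
    [ContMDiffVectorBundle ω F V 𝓘(ℂ, E)]
    (s : Cₛ^ω⟮𝓘(ℂ, E); F, V⟯) (hZ : IsCompact {x | s x = 0}) :
    QuasiIso (DolbeaultKoszul.inclusionEc s n) :=
  DolbeaultKoszul.quasiIso_inclusionEc s hZ n
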